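/- Let $X_1,X_2,\dots$ be i.i.d. real random variables with $E X_1=0$ and $E X_1^2=1$. Put $M_n=\max_{1\le i\le n}X_i$ and $S_n=\sum_{i=1}^n X_i$. Suppose that there are constants $a_n>0$ and $b_n\in\mathbb R$ ($n\ge1$) such that $$\lim_{n\to\infty}P\bigl(a_n(M_n-b_n)\le t\bigr)=G(t)\qquad\text{for all } t\in\mathbb R,$$ where $G$ is one of the following distribution functions: the Gumbel law $\Lambda(t)=\exp(-e^{-t})$; the Fréchet law $\Phi_\alpha(t)=\exp(-t^{-\alpha})$ for $t>0$ and $\Phi_\alpha(t)=0$ for $t\le0$, for some $\alpha>2$; or the Weibull law $\Psi_\alpha(t)=\exp(-(-t)^{\alpha})$ for $t\le0$ and $\Psi_\alpha(t)=1$ for $t>0$, for some $\alpha>0$. Let $x\in\mathbb R$ with $G(x)>0$, put $u_n=a_n^{-1}x+b_n$, and let $$N_n^X(B)=\sum_{i=1}^n I\bigl(X_i>u_n,\ i/n\in B\bigr),\qquad B\subseteq(0,1]\ \text{Borel},$$ be the point process on $(0,1]$ of exceedances of $u_n$. Then: 1. $N_n^X$ converges in distribution, as a random element of the space of finite measures on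 $(0,1]$ with the topology of weak convergence, to a Poisson process $N$ on $(0,1]$ with intensity $-\log G(x)$; that is, the limit $N$ satisfies that $N(B)$ is Poisson distributed with parameter $-\log G(x)\cdot\mathrm{Leb}(B)$ for every Borel set $B\subseteq(0,1]$, and $N(B_1),\dots,N(B_k)$ are independent for pairwise disjoint Borel sets $B_1,\dots,B_k$. 2. $N_n^X$ and $S_n/\sqrt n$ are asymptotically independent: for every bounded continuous real function $f$ on the product of the above space of finite measures with $\mathbb R$, $$E f\bigl(N_n^X,\,S_n/\sqrt n\bigr)-\iint f(m,s)\,P_{N_n^X}(dm)\,P_{S_n/\sqrt n}(ds)\longrightarrow 0\qquad(n\to\infty),$$ where $P_{N_n^X}$ and $P_{S_n/\sqrt n}$ denote the laws of $N_n^X$ and $S_n/\sqrt n$. -/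

import Mathlib

open MeasureTheory ProbabilityTheory Filter Topology
open scoped NNReal ENNReal BoundedContinuousFunction

noncomputable section

/-- The Gumbel distribution function `Λ`. -/
def gumbelCDF (x : ℝ) : ℝ := Real.exp (-Real.exp (-x))

/-- The Fréchet distribution function `Φ_α`. -/
def frechetCDF (α x : ℝ) : ℝ := if x ≤ 0 then 0 else Real.exp (-x ^ (-α))

/-- The (reversed) Weibull distribution function `Ψ_α`. -/
def weibullCDF (α x : ℝ) : ℝ := if x ≤ 0 then Real.exp (-(-x) ^ α) else 1

/-- `G` is the Gumbel law, a Fréchet law with `α > 2`, or a Weibull law with `α > 0`. -/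
def IsAdmissibleExtremeValueCDF (G : ℝ → ℝ) : Prop :=
  G = gumbelCDF ∨ (∃ α : ℝ, 2 < α ∧ G = frechetCDF α) ∨ (∃ α : ℝ, 0 < α ∧ G = weibullCDF α)

/-- The maximum of the first `n` variables; the sequence is indexed from `0`, so that `X i` is the
`(i + 1)`-st variable. (The value at `n = 0` is `0`.) -/
def partialMax {Ω : Type*} (X : ℕ → Ω → ℝ) (n : ℕ) (ω : Ω) : ℝ := ⨆ i : Fin n, X i ω

/-- The sum of the first `n` variables. -/
def partialSum {Ω : Type*} (X : ℕ → Ω → ℝ) (n : ℕ) (ω : Ω) : ℝ := ∑ i : Fin n, X i ω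

/-- The time point `(i + 1) / n` of `(0, 1]` that belongs to the `(i + 1)`-st variable. -/
def timePoint (n : ℕ) (i : Fin n) : Set.Ioc (0 : ℝ) 1 :=
  ⟨((i : ℝ) + 1) / n, by
    have h : (0 : ℝ) < n := by exact_mod_cast i.pos
    have h' : ((i : ℝ) + 1) ≤ n := by exact_mod_cast i.isLt
    exact ⟨by positivity, (div_le_one h).2 h'⟩⟩

open scoped Classical in
/-- The point process on `(0, 1]` of exceedances of the levels `u n`: a unit mass at the time point
of each of the first `n` variables that exceeds `u n`. -/
def exceedanceProcess {Ω : Type*} (X : ℕ → Ω → ℝ) (u : ℕ → ℝ) (n : ℕ) (ω : Ω) :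
    FiniteMeasure (Set.Ioc (0 : ℝ) 1) :=
  ∑ i : Fin n, if u n < X i ω then (diracProba (timePoint n i)).toFiniteMeasure else 0

open scoped Classical in
/-- The mass that the exceedance process gives to `B` is the number of exceedances in `B`. -/
theorem exceedanceProcess_apply {Ω : Type*} (X : ℕ → Ω → ℝ) (u : ℕ → ℝ) (n : ℕ) (ω : Ω)
    {B : Set (Set.Ioc (0 : ℝ) 1)} (hB : MeasurableSet B) :
    (exceedanceProcess X u n ω : Measure (Set.Ioc (0 : ℝ) 1)) B =
      ∑ i : Fin n, if u n < X i ω ∧ timePoint n i ∈ B then 1 else 0 := by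
  rw [exceedanceProcess, FiniteMeasure.toMeasure_sum, Measure.finsetSum_apply]
  refine Finset.sum_congr rfl fun i _ => ?_
  by_cases h : u n < X i ω
  · have hd : ((diracProba (timePoint n i)).toFiniteMeasure : Measure (Set.Ioc (0 : ℝ) 1)) =
        Measure.dirac (timePoint n i) := rfl
    rw [if_pos h, hd, Measure.dirac_apply' _ hB]
    simp [h, Set.indicator_apply]
  · simp [h]

/-- Lebesgue measure on `(0, 1]`. -/
def lebesgueIoc : FiniteMeasure (Set.Ioc (0 : ℝ) 1) :=
  ⟨Measure.comap Subtype.val (volume : Measure ℝ), ⟨by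
    rw [comap_subtype_coe_apply measurableSet_Ioc, Set.image_univ, Subtype.range_coe,
      Real.volume_Ioc]
    exact ENNReal.ofReal_lt_top⟩⟩

/-- `N` is a Poisson process with (finite) intensity measure `Λ`: the number of points in a
measurable set `B` has the Poisson law with parameter `Λ B`, and the numbers of points in finitely
many pairwise disjoint measurable sets are independent. -/
structure IsPoissonProcess {E Ω : Type*} [MeasurableSpace E] [MeasurableSpace Ω]
    (N : Ω → FiniteMeasure E) (Λ : FiniteMeasure E) (P : Measure Ω) : Prop where
  hasLaw : ∀ B : Set E, MeasurableSet B →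
    HasLaw (fun ω => N ω B) ((poissonMeasure (Λ B)).map (Nat.cast : ℕ → ℝ≥0)) P
  indep : ∀ (k : ℕ) (B : Fin k → Set E), (∀ j, MeasurableSet (B j)) →
    Pairwise (fun i j => Disjoint (B i) (B j)) → iIndepFun (fun j ω => N ω (B j)) P

/-- Convergence in distribution of the random elements `X n` of the topological space `E` to `Z`:
all of them are Borel measurable (up to null sets), and their laws on the Borel σ-algebra
converge weakly. For `E = FiniteMeasure S` the topology is that of weak convergence of finite
measures on `S`. -/
def TendstoInLaw {E Ω Ω' : Type*} [TopologicalSpace E] [MeasurableSpace Ω] [MeasurableSpace Ω']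
    (X : ℕ → Ω → E) (Z : Ω' → E) (μ : Measure Ω) [IsProbabilityMeasure μ]
    (μ' : Measure Ω') [IsProbabilityMeasure μ'] : Prop :=
  letI : MeasurableSpace E := borel E
  haveI : BorelSpace E := ⟨rfl⟩
  TendstoInDistribution X atTop Z (fun _ => μ) μ'

/-- Asymptotic independence: the joint law of `(X n, Y n)` and the product of the laws of `X n` and
of `Y n` are asymptotically equal, when tested against bounded continuous functions. -/
def AsymptoticallyIndependent {E F Ω : Type*} [TopologicalSpace E] [TopologicalSpace F]
    [MeasurableSpace Ω] (X : ℕ → Ω → E) (Y : ℕ → Ω → F) (μ : Measure Ω) : Prop :=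
  ∀ f : (E × F) →ᵇ ℝ,
    Tendsto (fun n => ∫ ω, f (X n ω, Y n ω) ∂μ - ∫ ω, ∫ ω', f (X n ω, Y n ω') ∂μ ∂μ)
      atTop (𝓝 0)

end

/-! Let `p n` be the probability that one variable exceeds the level `u n`. The maximum of `n`
variables stays below `u n` with probability `(1 - p n) ^ n`, so the convergence of the maxima at
the single point `x` gives `n * p n → r = -log G(x)`.

The exceedance process is a function of the marks "variable `i` exceeds `u n`", which are
independent Bernoulli variables with parameter `p n`. A Poisson process with intensity `r` on `(0,
1]` occupies the `n` grid cells independently, each with probability `1 - exp (-r / n)`. Both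
parameters are `r / n + o(1 / n)`, so the two laws of marks merge in total variation. An average
over the marks may thus be replaced by an average over one fixed Poisson sample, along which almost
surely the marked point measures converge and the number of marks is eventually constant
(`tendsto_sum_prod_bernoulliWeight_mul`). Convergence to the Poisson process follows by dominated
convergence.

For independence, condition on the marks. The variables remain independent, with laws conditioned to
lie above or below `u n`. Finitely many large variables are negligible after division by `√n`,
because the second moment is finite; conditioning the others to be small changes their
characteristic functions by `o(1 / n)` each. Hence the normalized sum has the same Gaussian limit
given the marks as without conditioning (`tendsto_prod_charFun_levelCond`). -/

/-! ### Construction of the Poisson process from a Poisson number of independent points -/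

/-- The point measure `∑ i < k, δ (u i)`. -/
noncomputable def samplePointMeasure {E : Type*} [MeasurableSpace E] (ω : ℕ × (ℕ → E)) :
    FiniteMeasure E :=
  ∑ i ∈ Finset.range ω.1, (diracProba (ω.2 i)).toFiniteMeasure

/-- A Poisson number of points together with a sequence of independent points of law `ρ`. -/
noncomputable def poissonSampleMeasure {E : Type*} [MeasurableSpace E] (r : ℝ≥0) (ρ : Measure E)
    [IsProbabilityMeasure ρ] : Measure (ℕ × (ℕ → E)) :=
  (poissonMeasure r).prod (Measure.infinitePi fun _ => ρ)

instance {E : Type*} [MeasurableSpace E] (r : ℝ≥0) (ρ : Measure E) [IsProbabilityMeasure ρ] :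
    IsProbabilityMeasure (poissonSampleMeasure r ρ) := by
  unfold poissonSampleMeasure; infer_instance

theorem FiniteMeasure.sum_diracProba_apply {E ι : Type*} [MeasurableSpace E] (s : Finset ι)
    (u : ι → E) {B : Set E} (hB : MeasurableSet B) :
    ((∑ i ∈ s, (diracProba (u i)).toFiniteMeasure : FiniteMeasure E) B) =
      ∑ i ∈ s, B.indicator (1 : E → ℝ≥0) (u i) := by
  have hd : ∀ i, ((diracProba (u i)).toFiniteMeasure : Measure E) = Measure.dirac (u i) :=
    fun i => rfl
  apply ENNReal.coe_injective
  rw [FiniteMeasure.ennreal_coeFn_eq_coeFn_toMeasure, FiniteMeasure.toMeasure_sum,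
    Measure.finsetSum_apply, ENNReal.ofNNReal_finsetSum]
  refine Finset.sum_congr rfl fun i _ => ?_
  rw [hd, Measure.dirac_apply' _ hB]
  by_cases h : u i ∈ B <;> simp [h]

theorem samplePointMeasure_apply {E : Type*} [MeasurableSpace E] (ω : ℕ × (ℕ → E)) {B : Set E}
    (hB : MeasurableSet B) :
    samplePointMeasure ω B = ∑ i ∈ Finset.range ω.1, B.indicator (1 : E → ℝ≥0) (ω.2 i) :=
  FiniteMeasure.sum_diracProba_apply _ _ hB

theorem measurable_sum_range_fst {E M : Type*} [MeasurableSpace E] [MeasurableSpace M]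
    [AddCommMonoid M] [MeasurableAdd₂ M] {g : E → M} (hg : Measurable g) :
    Measurable fun ω : ℕ × (ℕ → E) => ∑ i ∈ Finset.range ω.1, g (ω.2 i) := by
  refine measurable_from_prod_countable_right fun k => ?_
  exact Finset.measurable_fun_sum (Finset.range k) (f := fun i (u : ℕ → E) => g (u i))
    fun i _ => hg.comp (measurable_pi_apply i)

theorem measurable_samplePointMeasure_apply {E : Type*} [MeasurableSpace E] {B : Set E}
    (hB : MeasurableSet B) : Measurable fun ω : ℕ × (ℕ → E) => samplePointMeasure ω B := by
  simp_rw [samplePointMeasure_apply _ hB]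
  exact measurable_sum_range_fst (measurable_one.indicator hB)

theorem integral_exp_sum_infinitePi {E : Type*} [MeasurableSpace E] (ρ : Measure E)
    [IsProbabilityMeasure ρ] {g : E → ℝ} (hg : Measurable g) (k : ℕ) :
    ∫ u : ℕ → E, Complex.exp ((∑ i ∈ Finset.range k, g (u i) : ℝ) * Complex.I)
        ∂(Measure.infinitePi fun _ => ρ) =
      (∫ y, Complex.exp (g y * Complex.I) ∂ρ) ^ k := by
  have hind : iIndepFun (fun i (u : ℕ → E) => g (u i)) (Measure.infinitePi fun _ => ρ) :=
    iIndepFun_infinitePi (X := fun _ => g) fun _ => hg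
  have hm : ∀ i : ℕ, Measurable fun u : ℕ → E => g (u i) :=
    fun i => hg.comp (measurable_pi_apply i)
  have h := congrFun (iIndepFun.charFun_map_fun_finsetSum_eq_prod (s := Finset.range k)
    (fun i _ => (hm i).aemeasurable) (hind.restrict _)) 1
  rw [charFun_apply_real, integral_map (Finset.measurable_fun_sum _ fun i _ => hm i).aemeasurable
    (by fun_prop)] at h
  simp only [Complex.ofReal_one, one_mul] at h
  rw [h, Finset.prod_apply, ← Finset.card_range k, ← Finset.prod_const, Finset.card_range]
  refine Finset.prod_congr rfl fun i _ => ?_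
  have hmap : (Measure.infinitePi fun _ : ℕ => ρ).map (fun u : ℕ → E => g (u i)) = ρ.map g := by
    conv_rhs => rw [← Measure.infinitePi_map_eval (fun _ : ℕ => ρ) i]
    rw [Measure.map_map hg (measurable_pi_apply i)]
    rfl
  rw [hmap, charFun_apply_real, integral_map hg.aemeasurable (by fun_prop)]
  simp

/-- Given `k` points, the integral is the `k`-th power of that for one point; summing over `k`
against the Poisson weights gives an exponential series. -/
theorem integral_exp_poissonSampleMeasure {E : Type*} [MeasurableSpace E] (r : ℝ≥0)
    (ρ : Measure E) [IsProbabilityMeasure ρ] {g : E → ℝ} (hg : Measurable g) :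
    ∫ ω, Complex.exp ((∑ i ∈ Finset.range ω.1, g (ω.2 i) : ℝ) * Complex.I)
        ∂(poissonSampleMeasure r ρ) =
      Complex.exp (r * (∫ y, Complex.exp (g y * Complex.I) ∂ρ - 1)) := by
  have hint : Integrable (fun ω : ℕ × (ℕ → E) =>
      Complex.exp ((∑ i ∈ Finset.range ω.1, g (ω.2 i) : ℝ) * Complex.I))
      ((poissonMeasure r).prod (Measure.infinitePi fun _ => ρ)) := by
    refine Integrable.of_bound (C := 1) ?_ (ae_of_all _ fun ω => ?_)
    · exact (Complex.measurable_exp.comp ((Complex.measurable_ofReal.comp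
        (measurable_sum_range_fst hg)).mul_const _)).aestronglyMeasurable
    · rw [Complex.norm_exp_ofReal_mul_I]
  rw [poissonSampleMeasure, integral_prod _ hint]
  simp_rw [integral_exp_sum_infinitePi ρ hg]
  rw [integral_poissonMeasure]
  set φ := ∫ y, Complex.exp (g y * Complex.I) ∂ρ
  have h : ∀ n : ℕ, (Real.exp (-r) * r ^ n / n.factorial) • φ ^ n =
      Complex.exp (-r) * ((r * φ) ^ n / n.factorial) := by
    intro n
    rw [Complex.real_smul]
    push_cast
    ring
  simp_rw [h]
  rw [tsum_mul_left, mul_sub, mul_one, sub_eq_neg_add, Complex.exp_add, Complex.exp_eq_exp_ℂ,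
    NormedSpace.exp_eq_tsum_div]

/-- At most one of the disjoint sets contains `y`, so the exponential of the sum is linear in the
indicators. -/
theorem integral_exp_sum_indicator {E : Type*} [MeasurableSpace E] (ρ : Measure E)
    [IsProbabilityMeasure ρ] {k : ℕ} {B : Fin k → Set E} (hB : ∀ j, MeasurableSet (B j))
    (hd : Pairwise fun i j => Disjoint (B i) (B j)) (t : Fin k → ℝ) :
    ∫ y, Complex.exp ((∑ j, t j * (B j).indicator 1 y : ℝ) * Complex.I) ∂ρ - 1 =
      ∑ j, ρ.real (B j) * (Complex.exp (t j * Complex.I) - 1) := by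
  have hpt : ∀ y, Complex.exp ((∑ j, t j * (B j).indicator 1 y : ℝ) * Complex.I) =
      1 + ∑ j, (B j).indicator (fun _ => Complex.exp (t j * Complex.I) - 1) y := by
    intro y
    by_cases hy : ∃ j, y ∈ B j
    · obtain ⟨j, hj⟩ := hy
      have hne : ∀ i, i ≠ j → y ∉ B i := fun i hij hi =>
        Set.disjoint_left.1 (hd hij) hi hj
      rw [Finset.sum_eq_single j, Finset.sum_eq_single j]
      · simp [hj]
      · intro i _ hij; simp [hne i hij]
      · simp
      · intro i _ hij; simp [hne i hij]
      · simp
    · push Not at hy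
      simp [hy]
  simp_rw [hpt]
  have hi : ∀ j, Integrable ((B j).indicator fun _ => Complex.exp (t j * Complex.I) - 1) ρ :=
    fun j => (integrable_const _).indicator (hB j)
  rw [integral_add (integrable_const _) (integrable_finsetSum _ fun j _ => hi j),
    integral_finsetSum _ fun j _ => hi j]
  simp only [integral_const, probReal_univ, one_smul, add_sub_cancel_left]
  refine Finset.sum_congr rfl fun j _ => ?_
  rw [integral_indicator_const _ (hB j), Complex.real_smul]

/-- The factorization over `j` yields independence of the counts, and the case of one set yields
their Poisson law. -/
theorem integral_exp_sum_samplePointMeasure {E : Type*} [MeasurableSpace E] (r : ℝ≥0)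
    (ρ : Measure E) [IsProbabilityMeasure ρ] {k : ℕ} {B : Fin k → Set E}
    (hB : ∀ j, MeasurableSet (B j)) (hd : Pairwise fun i j => Disjoint (B i) (B j))
    (t : Fin k → ℝ) :
    ∫ ω, Complex.exp ((∑ j, t j * (samplePointMeasure ω (B j) : ℝ) : ℝ) * Complex.I)
        ∂(poissonSampleMeasure r ρ) =
      ∏ j, Complex.exp (r * ρ.real (B j) * (Complex.exp (t j * Complex.I) - 1)) := by
  have hg : Measurable fun y => ∑ j, t j * (B j).indicator (1 : E → ℝ) y :=
    Finset.measurable_fun_sum _ fun j _ => (measurable_one.indicator (hB j)).const_mul _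
  have h := integral_exp_poissonSampleMeasure r ρ hg
  rw [integral_exp_sum_indicator ρ hB hd t, Finset.mul_sum, Complex.exp_sum] at h
  simp_rw [← mul_assoc] at h
  rw [← h]
  congr 1
  ext ω
  congr 3
  rw [Finset.sum_comm]
  refine Finset.sum_congr rfl fun j _ => ?_
  rw [samplePointMeasure_apply _ (hB j), NNReal.coe_sum, Finset.mul_sum]
  refine Finset.sum_congr rfl fun i _ => ?_
  by_cases h : ω.2 i ∈ B j <;> simp [h]

theorem charFun_samplePointMeasure {E : Type*} [MeasurableSpace E] (r : ℝ≥0)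
    (ρ : Measure E) [IsProbabilityMeasure ρ] {B : Set E} (hB : MeasurableSet B) (t : ℝ) :
    charFun ((poissonSampleMeasure r ρ).map fun ω => (samplePointMeasure ω B : ℝ)) t =
      Complex.exp (r * ρ.real B * (Complex.exp (t * Complex.I) - 1)) := by
  have hm := (measurable_samplePointMeasure_apply hB).coe_nnreal_real
  have h := integral_exp_sum_samplePointMeasure r ρ (k := 1) (B := fun _ => B) (fun _ => hB)
    (fun i j hij => absurd (Subsingleton.elim i j) hij) (fun _ => t)
  rw [charFun_apply_real, integral_map hm.aemeasurable (by fun_prop)]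
  simpa using h

/-- A Poisson number of independent points forms a Poisson process. -/
theorem isPoissonProcess_samplePointMeasure {E : Type*} [MeasurableSpace E] (r : ℝ≥0)
    (ρ : FiniteMeasure E) [IsProbabilityMeasure (ρ : Measure E)] :
    IsPoissonProcess samplePointMeasure (r • ρ) (poissonSampleMeasure r (ρ : Measure E)) where
  hasLaw B hB := by
    have hm := measurable_samplePointMeasure_apply hB
    refine ⟨hm.aemeasurable, ?_⟩
    -- The counts are moved into `ℝ`, where characteristic functions determine laws.
    have hemb : MeasurableEmbedding ((↑) : ℝ≥0 → ℝ) :=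
      NNReal.isClosedEmbedding_coe.measurableEmbedding
    apply hemb.map_injective
    rw [Measure.map_map hemb.measurable hm, Measure.map_map hemb.measurable (by fun_prop)]
    apply Measure.ext_of_charFun
    ext t
    have h2 : ((↑) : ℝ≥0 → ℝ) ∘ (Nat.cast : ℕ → ℝ≥0) = (Nat.cast : ℕ → ℝ) := by
      ext; simp
    rw [h2, charFun_map_cast_poissonMeasure]
    refine (charFun_samplePointMeasure r (ρ : Measure E) hB t).trans ?_
    congr 2
    rw [FiniteMeasure.smul_apply]
    simp [measureReal_def, FiniteMeasure.coeFn_def, ENNReal.coe_toNNReal_eq_toReal]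
  indep k B hB hd := by
    have hm := fun j => (measurable_samplePointMeasure_apply (hB j)).coe_nnreal_real
    have h : iIndepFun (fun j ω => (samplePointMeasure ω (B j) : ℝ))
        (poissonSampleMeasure r (ρ : Measure E)) := by
      rw [iIndepFun_iff_charFun_pi fun j => (hm j).aemeasurable]
      intro t
      have hL : Measurable fun ω : ℕ × (ℕ → E) =>
          WithLp.toLp 2 fun j => (samplePointMeasure ω (B j) : ℝ) :=
        (WithLp.measurable_toLp 2 _).comp (measurable_pi_lambda _ hm)
      simp_rw [fun j => charFun_samplePointMeasure r (ρ : Measure E) (hB j) (t j)]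
      rw [← integral_exp_sum_samplePointMeasure r (ρ : Measure E) hB hd, charFun_apply,
        integral_map hL.aemeasurable (by fun_prop)]
      congr 1
    convert! h.comp (fun _ => Real.toNNReal) (fun _ => measurable_real_toNNReal) using 1
    ext j ω
    simp

/-! ### Lebesgue measure on `(0, 1]`, measurability and distinctness of the sample points -/

instance : IsProbabilityMeasure (lebesgueIoc : Measure (Set.Ioc (0 : ℝ) 1)) := ⟨by
  change Measure.comap Subtype.val (volume : Measure ℝ) Set.univ = 1
  rw [comap_subtype_coe_apply measurableSet_Ioc, Set.image_univ, Subtype.range_coe,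
    Real.volume_Ioc]
  simp⟩

instance : NullSingletonClass (lebesgueIoc : Measure (Set.Ioc (0 : ℝ) 1)) := ⟨fun x => by
  change Measure.comap Subtype.val (volume : Measure ℝ) {x} = 0
  rw [comap_subtype_coe_apply measurableSet_Ioc]
  simp⟩

theorem continuous_toFiniteMeasure_diracProba {E : Type*} [TopologicalSpace E] [MeasurableSpace E]
    [OpensMeasurableSpace E] :
    Continuous fun x : E => (diracProba x).toFiniteMeasure :=
  ProbabilityMeasure.toFiniteMeasure_continuous.comp continuous_diracProba

/-- For each of the countably many values of the number of points, the point measure depends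
continuously on the points. Second countability makes the product σ-algebra on sequences the Borel
one. -/
theorem measurable_borel_samplePointMeasure {E : Type*} [TopologicalSpace E]
    [SecondCountableTopology E] [MeasurableSpace E] [BorelSpace E] :
    @Measurable _ _ _ (borel (FiniteMeasure E)) (samplePointMeasure (E := E)) := by
  let : MeasurableSpace (FiniteMeasure E) := borel _
  have : BorelSpace (FiniteMeasure E) := ⟨rfl⟩
  refine measurable_from_prod_countable_right fun k => ?_
  have : Continuous fun u : ℕ → E =>
      ∑ i ∈ Finset.range k, (diracProba (u i)).toFiniteMeasure :=
    continuous_finsetSum _ fun i _ =>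
      continuous_toFiniteMeasure_diracProba.comp (continuous_apply i)
  exact this.measurable

/-- By Fubini the diagonal is null when singletons are, and there are only countably many pairs of
indices. -/
theorem ae_injective_infinitePi {E : Type*} [MeasurableSpace E] [MeasurableEq E]
    (ρ : Measure E) [IsProbabilityMeasure ρ] [NullSingletonClass ρ] :
    ∀ᵐ u : ℕ → E ∂(Measure.infinitePi fun _ => ρ), Function.Injective u := by
  have h : ∀ i j : ℕ, i ≠ j → ∀ᵐ u : ℕ → E ∂(Measure.infinitePi fun _ => ρ), u i ≠ u j := by
    intro i j hij
    have hm : Measurable fun u : ℕ → E => (u i, u j) := by fun_prop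
    have hd : MeasurableSet {p : E × E | p.1 = p.2} := measurableSet_diagonal
    have h0 : (ρ.prod ρ) {p : E × E | p.1 = p.2} = 0 := by
      rw [Measure.measure_prod_null hd]
      refine ae_of_all _ fun x => ?_
      have : Prod.mk x ⁻¹' {p : E × E | p.1 = p.2} = {x} := by ext y; simp [eq_comm]
      simp [this]
    rw [← Measure.infinitePi_map_eval_prod (P := fun _ : ℕ => ρ) hij,
      Measure.map_apply hm hd] at h0
    exact compl_mem_ae_iff.2 h0
  have h' : ∀ᵐ u : ℕ → E ∂(Measure.infinitePi fun _ => ρ), ∀ i j : ℕ, i ≠ j → u i ≠ u j := by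
    rw [ae_all_iff]; intro i
    rw [ae_all_iff]; intro j
    by_cases hij : i = j
    · exact ae_of_all _ fun u h => absurd hij h
    · filter_upwards [h i j hij] with u hu _ using hu
  filter_upwards [h'] with u hu i j hij
  by_contra hne
  exact hu i j hne hij

theorem ae_injective_poissonSampleMeasure {E : Type*} [MeasurableSpace E] [MeasurableEq E]
    (r : ℝ≥0) (ρ : Measure E) [IsProbabilityMeasure ρ] [NullSingletonClass ρ] :
    ∀ᵐ ω ∂(poissonSampleMeasure r ρ), Function.Injective ω.2 :=
  Measure.quasiMeasurePreserving_snd.ae (ae_injective_infinitePi ρ)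

/-- Needed for the degenerate intensity `0`, that is, for `G x = 1`. -/
theorem ae_fst_eq_zero_poissonSampleMeasure {E : Type*} [MeasurableSpace E]
    (ρ : Measure E) [IsProbabilityMeasure ρ] :
    ∀ᵐ ω ∂(poissonSampleMeasure 0 ρ), ω.1 = 0 := by
  refine Measure.quasiMeasurePreserving_fst.ae (p := fun k => k = 0) ?_
  have h : poissonMeasure 0 {0} = 1 := by simp [poissonMeasure_singleton]
  exact (prob_compl_eq_zero_iff (MeasurableSet.singleton 0)).2 h

/-! ### Grid cells and their occupancy by the Poisson sample -/

/-- The set of points `y` of `(0, 1]` with `i / n < y ≤ (i + 1) / n`. -/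
def gridCell (n : ℕ) (i : Fin n) : Set (Set.Ioc (0 : ℝ) 1) :=
  {y | ⌈(n : ℝ) * y⌉₊ = i + 1}

/-- The index of the grid cell that contains `y`. -/
noncomputable def gridIndex (n : ℕ) (hn : 0 < n) (y : Set.Ioc (0 : ℝ) 1) : Fin n :=
  ⟨⌈(n : ℝ) * y⌉₊ - 1, by
    have h : ⌈(n : ℝ) * y⌉₊ ≤ n := Nat.ceil_le.2 (by
      have := y.2.2
      have hn' : (0 : ℝ) ≤ n := n.cast_nonneg
      nlinarith)
    omega⟩

theorem mem_gridCell_iff {n : ℕ} (hn : 0 < n) {i : Fin n} {y : Set.Ioc (0 : ℝ) 1} :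
    y ∈ gridCell n i ↔ gridIndex n hn y = i := by
  have hpos : 0 < ⌈(n : ℝ) * y⌉₊ := Nat.ceil_pos.2 (mul_pos (by exact_mod_cast hn) y.2.1)
  simp only [gridCell, gridIndex, Set.mem_ofPred_eq, Fin.ext_iff]
  omega

theorem measurableSet_gridCell (n : ℕ) (i : Fin n) : MeasurableSet (gridCell n i) := by
  have : Measurable fun y : Set.Ioc (0 : ℝ) 1 => ⌈(n : ℝ) * y⌉₊ := by fun_prop
  exact this (MeasurableSet.singleton _)

theorem disjoint_gridCell (n : ℕ) :
    Pairwise fun i j => Disjoint (gridCell n i) (gridCell n j) := by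
  intro i j hij
  refine Set.disjoint_left.2 fun y hi hj => hij ?_
  simp only [gridCell, Set.mem_ofPred_eq] at hi hj
  exact Fin.ext (by omega)

theorem lebesgueIoc_gridCell (n : ℕ) (i : Fin n) :
    (lebesgueIoc (gridCell n i) : ℝ) = 1 / n := by
  have hn : (0 : ℝ) < n := by exact_mod_cast i.pos
  have hi : ((i : ℝ) + 1) ≤ n := by exact_mod_cast i.isLt
  have himg : Subtype.val '' gridCell n i = Set.Ioc ((i : ℝ) / n) ((i + 1) / n) := by
    ext y
    simp only [gridCell, Set.mem_image, Set.mem_ofPred_eq, Subtype.exists, exists_and_right,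
      exists_eq_right, Set.mem_Ioc]
    rw [div_lt_iff₀' hn, le_div_iff₀' hn]
    constructor
    · rintro ⟨h, hc⟩
      rw [Nat.ceil_eq_iff (by omega)] at hc
      simpa using hc
    · rintro ⟨h1, h2⟩
      have hi0 : (0 : ℝ) ≤ i := Nat.cast_nonneg _
      refine ⟨⟨pos_of_mul_pos_right (lt_of_le_of_lt hi0 h1) hn.le, ?_⟩, ?_⟩
      · by_contra! h
        nlinarith
      · rw [Nat.ceil_eq_iff (by omega)]
        simpa using ⟨h1, h2⟩
  change ((Measure.comap Subtype.val (volume : Measure ℝ)) (gridCell n i)).toReal = _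
  rw [comap_subtype_coe_apply measurableSet_Ioc, himg, Real.volume_Ioc,
    ENNReal.toReal_ofReal] <;> rw [← sub_div, add_sub_cancel_left]
  positivity

/-- The time point is `⌈n y⌉ / n`, the right end of the cell of `y`. The shift to `n + 1` keeps the
grid nonempty. -/
theorem tendsto_timePoint_gridIndex (y : Set.Ioc (0 : ℝ) 1) :
    Tendsto (fun n : ℕ => timePoint (n + 1) (gridIndex (n + 1) n.succ_pos y)) atTop (𝓝 y) := by
  rw [tendsto_subtype_rng]
  have hval : ∀ n : ℕ, ((timePoint (n + 1) (gridIndex (n + 1) n.succ_pos y) :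
      Set.Ioc (0 : ℝ) 1) : ℝ) = ⌈((n + 1 : ℕ) : ℝ) * y⌉₊ / ((n + 1 : ℕ) : ℝ) := by
    intro n
    have hpos : 0 < ⌈((n + 1 : ℕ) : ℝ) * y⌉₊ :=
      Nat.ceil_pos.2 (mul_pos (by positivity) y.2.1)
    simp only [timePoint, gridIndex]
    rw [← Nat.cast_succ, Nat.succ_eq_add_one, Nat.sub_add_cancel hpos]
  simp_rw [hval]
  have h := (tendsto_nat_ceil_mul_div_atTop (R := ℝ) y.2.1.le).comp
    (tendsto_natCast_atTop_atTop.comp (tendsto_add_atTop_nat 1))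
  refine h.congr fun n => ?_
  simp [mul_comm]

/-- The point measure with a unit mass at each time point that is marked by `β`. -/
noncomputable def markedPointMeasure (n : ℕ) (β : Fin n → Bool) :
    FiniteMeasure (Set.Ioc (0 : ℝ) 1) :=
  ∑ i, if β i then (diracProba (timePoint n i)).toFiniteMeasure else 0

open scoped Classical in
/-- Marks the grid cells that contain one of the points of the sample `ω`. -/
noncomputable def occupancy (n : ℕ) (ω : ℕ × (ℕ → Set.Ioc (0 : ℝ) 1)) (i : Fin n) : Bool :=
  decide (∃ j < ω.1, ω.2 j ∈ gridCell n i)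

theorem occupancy_eq_true_iff {n : ℕ} {ω : ℕ × (ℕ → Set.Ioc (0 : ℝ) 1)} {i : Fin n} :
    occupancy n ω i = true ↔ samplePointMeasure ω (gridCell n i) ≠ 0 := by
  classical
  rw [samplePointMeasure_apply _ (measurableSet_gridCell n i), occupancy, decide_eq_true_iff]
  simp [Finset.sum_eq_zero_iff]

/-- The time points of two different points have different limits, so the cells differ eventually.
-/
theorem eventually_injOn_gridIndex {u : ℕ → Set.Ioc (0 : ℝ) 1} (hu : Function.Injective u)
    (k : ℕ) : ∀ᶠ n : ℕ in atTop,
      Set.InjOn (fun j => gridIndex (n + 1) n.succ_pos (u j)) (Finset.range k) := by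
  have h : ∀ i j : ℕ, i ≠ j → ∀ᶠ n : ℕ in atTop,
      gridIndex (n + 1) n.succ_pos (u i) ≠ gridIndex (n + 1) n.succ_pos (u j) := by
    intro i j hij
    filter_upwards [((tendsto_timePoint_gridIndex (u i)).prodMk_nhds
      (tendsto_timePoint_gridIndex (u j))).eventually
      (isClosed_diagonal.isOpen_compl.mem_nhds (hu.ne hij))] with n hn heq
    exact hn (by rw [heq]; rfl)
  have h' : ∀ᶠ n : ℕ in atTop, ∀ i ∈ Finset.range k, ∀ j ∈ Finset.range k, i ≠ j →
      gridIndex (n + 1) n.succ_pos (u i) ≠ gridIndex (n + 1) n.succ_pos (u j) := by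
    rw [Filter.eventually_all_finset]; intro i _
    rw [Filter.eventually_all_finset]; intro j _
    by_cases hij : i = j
    · exact Eventually.of_forall fun n hne => absurd hij hne
    · filter_upwards [h i j hij] with n hn _ using hn
  filter_upwards [h'] with n hn i hi j hj hij
  by_contra hne
  exact hn i hi j hj hne hij

theorem filter_occupancy (n : ℕ) (ω : ℕ × (ℕ → Set.Ioc (0 : ℝ) 1)) :
    Finset.univ.filter (fun i => occupancy (n + 1) ω i = true) =
      (Finset.range ω.1).image fun j => gridIndex (n + 1) n.succ_pos (ω.2 j) := by
  ext i
  simp [occupancy, mem_gridCell_iff n.succ_pos]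

/-- Once the points are separated by the grid, every occupied cell holds exactly one. This bounds
the number of variables that are conditioned to be large. -/
theorem eventually_card_occupancy {ω : ℕ × (ℕ → Set.Ioc (0 : ℝ) 1)}
    (hω : Function.Injective ω.2) :
    ∀ᶠ n : ℕ in atTop, (Finset.univ.filter fun i => occupancy n ω i = true).card = ω.1 := by
  have h : ∀ᶠ n : ℕ in atTop,
      (Finset.univ.filter fun i => occupancy (n + 1) ω i = true).card = ω.1 := by
    filter_upwards [eventually_injOn_gridIndex hω ω.1] with n hn
    rw [filter_occupancy, Finset.card_image_of_injOn hn, Finset.card_range]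
  obtain ⟨n₀, hn₀⟩ := eventually_atTop.1 h
  filter_upwards [eventually_ge_atTop (n₀ + 1)] with n hn
  obtain ⟨m, rfl⟩ : ∃ m, n = m + 1 := ⟨n - 1, by omega⟩
  exact hn₀ m (by omega)

theorem tendsto_markedPointMeasure_occupancy {ω : ℕ × (ℕ → Set.Ioc (0 : ℝ) 1)}
    (hω : Function.Injective ω.2) :
    Tendsto (fun n => markedPointMeasure n (occupancy n ω)) atTop (𝓝 (samplePointMeasure ω)) := by
  rw [← tendsto_add_atTop_iff_nat 1]
  have hlim : Tendsto (fun n : ℕ => ∑ j ∈ Finset.range ω.1, (diracProba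
      (timePoint (n + 1) (gridIndex (n + 1) n.succ_pos (ω.2 j)))).toFiniteMeasure) atTop
      (𝓝 (samplePointMeasure ω)) :=
    tendsto_finsetSum _ fun j _ => (continuous_toFiniteMeasure_diracProba.tendsto _).comp
      (tendsto_timePoint_gridIndex (ω.2 j))
  refine hlim.congr' ?_
  filter_upwards [eventually_injOn_gridIndex hω ω.1] with n hn
  rw [markedPointMeasure, ← Finset.sum_filter, filter_occupancy, Finset.sum_image hn]

/-! ### Total variation comparison of Bernoulli marks and occupancies -/

/-- The weights of the Bernoulli law with parameter `p`. -/
def bernoulliWeight (p : ℝ) (b : Bool) : ℝ := if b then p else 1 - p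

theorem bernoulliWeight_nonneg {p : ℝ} (h0 : 0 ≤ p) (h1 : p ≤ 1) (b : Bool) :
    0 ≤ bernoulliWeight p b := by
  cases b <;> simp [bernoulliWeight, h0, h1]

theorem sum_prod_bernoulliWeight (p : ℝ) (n : ℕ) :
    ∑ β : Fin n → Bool, ∏ i, bernoulliWeight p (β i) = 1 := by
  rw [← Fintype.prod_sum (fun (_ : Fin n) b => bernoulliWeight p b)]
  simp [bernoulliWeight]

/-- By induction on the first mark: exchanging one factor costs `|p - q|` for each of its two
values, and the remaining weights sum to `1`. -/
theorem sum_abs_prod_bernoulliWeight_sub_le {p q : ℝ} (hp0 : 0 ≤ p) (hp1 : p ≤ 1) (hq0 : 0 ≤ q)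
    (hq1 : q ≤ 1) (n : ℕ) :
    ∑ β : Fin n → Bool, |∏ i, bernoulliWeight p (β i) - ∏ i, bernoulliWeight q (β i)| ≤
      2 * (n * |p - q|) := by
  induction n with
  | zero => simp
  | succ n ih =>
    rw [← (Fin.consEquiv fun _ : Fin (n + 1) => Bool).sum_comp, Fintype.sum_prod_type]
    simp only [Fin.prod_univ_succ, Fin.consEquiv_apply, Fin.cons_zero, Fin.cons_succ]
    have hA : ∀ β : Fin n → Bool, 0 ≤ ∏ i, bernoulliWeight p (β i) := fun β =>
      Finset.prod_nonneg fun i _ => bernoulliWeight_nonneg hp0 hp1 _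
    have hb : ∀ (b : Bool) (β : Fin n → Bool),
        |bernoulliWeight p b * ∏ i, bernoulliWeight p (β i) -
          bernoulliWeight q b * ∏ i, bernoulliWeight q (β i)| ≤
        |p - q| * ∏ i, bernoulliWeight p (β i) + bernoulliWeight q b *
          |∏ i, bernoulliWeight p (β i) - ∏ i, bernoulliWeight q (β i)| := by
      intro b β
      have hd : |bernoulliWeight p b - bernoulliWeight q b| = |p - q| := by
        cases b
        · simp only [bernoulliWeight]
          rw [abs_sub_comm p q]
          simp
        · simp [bernoulliWeight]
      have hsplit : bernoulliWeight p b * ∏ i, bernoulliWeight p (β i) -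
          bernoulliWeight q b * ∏ i, bernoulliWeight q (β i) =
          (bernoulliWeight p b - bernoulliWeight q b) * ∏ i, bernoulliWeight p (β i) +
          bernoulliWeight q b *
            (∏ i, bernoulliWeight p (β i) - ∏ i, bernoulliWeight q (β i)) := by ring
      rw [hsplit]
      refine (abs_add_le _ _).trans_eq ?_
      rw [abs_mul, abs_mul, hd, abs_of_nonneg (hA β),
        abs_of_nonneg (bernoulliWeight_nonneg hq0 hq1 b)]
    refine (Finset.sum_le_sum fun b _ => Finset.sum_le_sum fun β _ => hb b β).trans ?_
    simp_rw [Finset.sum_add_distrib, ← Finset.mul_sum, sum_prod_bernoulliWeight]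
    have ht : bernoulliWeight q true = q := rfl
    have hf : bernoulliWeight q false = 1 - q := rfl
    rw [Fintype.sum_bool, Fintype.sum_bool, ht, hf]
    push_cast
    linarith

theorem measurable_occupancy (n : ℕ) : Measurable (occupancy n) := by
  refine measurable_pi_lambda _ fun i => ?_
  have hN := measurable_samplePointMeasure_apply (measurableSet_gridCell n i)
  refine measurable_to_bool ?_
  have : (fun ω => occupancy n ω i) ⁻¹' {true} =
      (fun ω => samplePointMeasure ω (gridCell n i)) ⁻¹' {0}ᶜ := by
    ext ω
    exact occupancy_eq_true_iff
  rw [this]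
  exact hN (MeasurableSet.singleton _).compl

/-- The counts in the disjoint cells are independent and Poisson with parameter `r / n`, so a cell
is empty with probability `exp (-r / n)`. -/
theorem measureReal_occupancy_eq (r : ℝ≥0) (n : ℕ) (β : Fin n → Bool) :
    ((poissonSampleMeasure r (lebesgueIoc : Measure (Set.Ioc (0 : ℝ) 1))).map
      (occupancy n)).real {β} = ∏ i, bernoulliWeight (1 - Real.exp (-(r / n))) (β i) := by
  set P := poissonSampleMeasure r (lebesgueIoc : Measure (Set.Ioc (0 : ℝ) 1))
  have hP := isPoissonProcess_samplePointMeasure r lebesgueIoc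
  have hm := fun i => measurable_samplePointMeasure_apply (measurableSet_gridCell n i)
  have hind := hP.indep n (gridCell n) (measurableSet_gridCell n) (disjoint_gridCell n)
  have hz : ∀ i, P.real ((fun ω => samplePointMeasure ω (gridCell n i)) ⁻¹' {0}) =
      Real.exp (-(r / n)) := by
    intro i
    rw [measureReal_def, ← Measure.map_apply (hm i) (MeasurableSet.singleton _),
      (hP.hasLaw _ (measurableSet_gridCell n i)).map_eq,
      Measure.map_apply (by fun_prop) (MeasurableSet.singleton _)]
    have h0 : (Nat.cast : ℕ → ℝ≥0) ⁻¹' {0} = {0} := by ext; simp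
    rw [h0, ← measureReal_def, poissonMeasure_real_singleton]
    have hcell := lebesgueIoc_gridCell n i
    rw [FiniteMeasure.smul_apply, smul_eq_mul, NNReal.coe_mul, hcell]
    simp [div_eq_mul_inv]
  have hset : occupancy n ⁻¹' {β} = ⋂ i ∈ Finset.univ,
      (fun ω => samplePointMeasure ω (gridCell n i)) ⁻¹' (if β i then {0}ᶜ else {0}) := by
    ext ω
    simp only [Set.mem_preimage, Set.mem_singleton_iff, funext_iff, Finset.mem_univ,
      Set.iInter_true, Set.mem_iInter]
    refine forall_congr' fun i => ?_
    have h := occupancy_eq_true_iff (n := n) (ω := ω) (i := i)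
    cases hβ : β i
    · rw [← not_iff_not, Bool.not_eq_false, h]; simp
    · rw [h]; simp
  rw [measureReal_def, Measure.map_apply (measurable_occupancy n) (MeasurableSet.singleton _),
    hset, hind.measure_inter_preimage_eq_mul _ fun i _ => by
      split_ifs
      · exact (MeasurableSet.singleton _).compl
      · exact MeasurableSet.singleton _, ENNReal.toReal_prod]
  refine Finset.prod_congr rfl fun i _ => ?_
  rw [← measureReal_def]
  cases hβ : β i
  · simp only [Bool.false_eq_true, if_false]
    rw [hz]; simp [bernoulliWeight]
  · simp only [if_true]
    rw [Set.preimage_compl, probReal_compl_eq_one_sub (hm i (MeasurableSet.singleton _)), hz]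
    simp [bernoulliWeight]

/-- The error of the linear approximation is at most `n * (y n / n) ^ 2`, which vanishes. -/
theorem tendsto_nat_mul_one_sub_exp {y : ℕ → ℝ} {c : ℝ} (hy : Tendsto y atTop (𝓝 c)) :
    Tendsto (fun n : ℕ => n * (1 - Real.exp (-(y n / n)))) atTop (𝓝 c) := by
  have hz : Tendsto (fun n : ℕ => y n / n) atTop (𝓝 0) :=
    hy.div_atTop tendsto_natCast_atTop_atTop
  have hsq : Tendsto (fun n : ℕ => y n * (y n / n)) atTop (𝓝 0) := by
    simpa using hy.mul hz
  have hdiff : Tendsto (fun n : ℕ => n * (1 - Real.exp (-(y n / n))) - y n) atTop (𝓝 0) := by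
    refine squeeze_zero_norm' ?_ hsq
    filter_upwards [eventually_gt_atTop 0, hz.abs.eventually_le_const
      (show |(0 : ℝ)| < 1 by simp)] with n hn hle
    have hn' : (0 : ℝ) < n := by exact_mod_cast hn
    have h := Real.abs_exp_sub_one_sub_id_le (x := -(y n / n)) (by rwa [abs_neg])
    have heq : n * (1 - Real.exp (-(y n / n))) - y n =
        -(n * (Real.exp (-(y n / n)) - 1 - -(y n / n))) := by
      field_simp
      ring
    rw [heq, norm_neg, norm_mul, Real.norm_eq_abs, Real.norm_eq_abs, abs_of_pos hn']
    calc (n : ℝ) * |Real.exp (-(y n / n)) - 1 - -(y n / n)| ≤ n * (-(y n / n)) ^ 2 := by gcongr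
      _ = y n * (y n / n) := by field_simp
  simpa using hdiff.add hy

/-- Averages over independent Bernoulli marks with parameters `p n ~ r / n` converge to an integral
over the Poisson sample if the integrands converge along the occupancies. -/
theorem tendsto_sum_prod_bernoulliWeight_mul {r : ℝ≥0} {p : ℕ → ℝ} (hp0 : ∀ n, 0 ≤ p n)
    (hp1 : ∀ n, p n ≤ 1) (hp : Tendsto (fun n => n * p n) atTop (𝓝 r))
    {h : ∀ n, (Fin n → Bool) → ℝ} {C : ℝ} (hC : ∀ n β, |h n β| ≤ C)
    {g : ℕ × (ℕ → Set.Ioc (0 : ℝ) 1) → ℝ}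
    (hg : ∀ᵐ ω ∂(poissonSampleMeasure r (lebesgueIoc : Measure (Set.Ioc (0 : ℝ) 1))),
      Tendsto (fun n => h n (occupancy n ω)) atTop (𝓝 (g ω))) :
    Tendsto (fun n => ∑ β, (∏ i, bernoulliWeight (p n) (β i)) * h n β) atTop
      (𝓝 (∫ ω, g ω ∂(poissonSampleMeasure r
        (lebesgueIoc : Measure (Set.Ioc (0 : ℝ) 1))))) := by
  set P := poissonSampleMeasure r (lebesgueIoc : Measure (Set.Ioc (0 : ℝ) 1))
  -- With this parameter the Bernoulli average is exactly an integral over the Poisson sample.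
  set q : ℕ → ℝ := fun n => 1 - Real.exp (-(r / n)) with hq
  have hq0 : ∀ n, 0 ≤ q n := fun n => by
    have : 0 ≤ (r : ℝ) / n := by positivity
    simpa [hq] using this
  have hq1 : ∀ n, q n ≤ 1 := fun n => by simp [hq, Real.exp_nonneg]
  have hint : ∀ n, ∫ ω, h n (occupancy n ω) ∂P =
      ∑ β, (∏ i, bernoulliWeight (q n) (β i)) * h n β := by
    intro n
    rw [← integral_map (measurable_occupancy n).aemeasurable
      (measurable_of_finite (h n)).aestronglyMeasurable,
      integral_fintype (Integrable.of_bound (measurable_of_finite (h n)).aestronglyMeasurable C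
        (ae_of_all _ (hC n)))]
    refine Finset.sum_congr rfl fun β _ => ?_
    rw [measureReal_occupancy_eq, smul_eq_mul]
  have hlim : Tendsto (fun n => ∫ ω, h n (occupancy n ω) ∂P) atTop (𝓝 (∫ ω, g ω ∂P)) := by
    refine tendsto_integral_of_dominated_convergence (fun _ => C) (fun n => ?_)
      (integrable_const C) (fun n => ae_of_all _ fun ω => hC n _) hg
    exact ((measurable_of_finite (h n)).comp (measurable_occupancy n)).aestronglyMeasurable
  have hC0 : 0 ≤ C := (abs_nonneg _).trans (hC 0 fun _ => true)
  have hpq : Tendsto (fun n : ℕ => C * (2 * (n * |p n - q n|))) atTop (𝓝 0) := by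
    have h1 : Tendsto (fun n : ℕ => n * p n - n * q n) atTop (𝓝 0) := by
      simpa using hp.sub (tendsto_nat_mul_one_sub_exp (y := fun _ => (r : ℝ)) tendsto_const_nhds)
    have h2 := (h1.abs.const_mul 2).const_mul C
    simp only [abs_zero, mul_zero] at h2
    refine h2.congr fun n => ?_
    rw [← mul_sub, abs_mul, Nat.abs_cast]
  have hdiff : Tendsto (fun n => ∑ β, (∏ i, bernoulliWeight (p n) (β i)) * h n β -
      ∫ ω, h n (occupancy n ω) ∂P) atTop (𝓝 0) := by
    refine squeeze_zero_norm (fun n => ?_) hpq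
    rw [hint, ← Finset.sum_sub_distrib, Real.norm_eq_abs]
    refine (Finset.abs_sum_le_sum_abs _ _).trans ?_
    refine le_trans ?_ (mul_le_mul_of_nonneg_left (sum_abs_prod_bernoulliWeight_sub_le (hp0 n)
      (hp1 n) (hq0 n) (hq1 n) n) hC0)
    rw [Finset.mul_sum]
    refine Finset.sum_le_sum fun β _ => ?_
    rw [← sub_mul, abs_mul, mul_comm]
    exact mul_le_mul_of_nonneg_right (hC n β) (abs_nonneg _)
  simpa using hdiff.add hlim

/-! ### Conditioning on the set of exceedances -/

/-- The values above the level `u` (for `b = true`), or the other ones (for `b = false`). -/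
def levelSet (u : ℝ) (b : Bool) : Set ℝ := if b then Set.Ioi u else Set.Iic u

theorem measurableSet_levelSet (u : ℝ) (b : Bool) : MeasurableSet (levelSet u b) := by
  cases b
  · exact measurableSet_Iic
  · exact measurableSet_Ioi

theorem measureReal_levelSet (ρ : Measure ℝ) [IsProbabilityMeasure ρ] (u : ℝ) (b : Bool) :
    ρ.real (levelSet u b) = bernoulliWeight (ρ.real (Set.Ioi u)) b := by
  cases b
  · have h := probReal_compl_eq_one_sub (μ := ρ) (measurableSet_Ioi (a := u))
    rw [Set.compl_Ioi] at h
    exact h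
  · rfl

open scoped Classical in
/-- The conditional law on `levelSet u b`, with a dummy value if `levelSet u b` is a null set. -/
noncomputable def levelCond (ρ : Measure ℝ) (u : ℝ) (b : Bool) : Measure ℝ :=
  if ρ (levelSet u b) = 0 then Measure.dirac 0 else ρ[|levelSet u b]

instance (ρ : Measure ℝ) [IsProbabilityMeasure ρ] (u : ℝ) (b : Bool) :
    IsProbabilityMeasure (levelCond ρ u b) := by
  unfold levelCond
  split_ifs with h
  · infer_instance
  · exact cond_isProbabilityMeasure h

/-- For a null set both sides vanish, so the dummy value of `levelCond` does no harm. -/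
theorem restrict_levelSet (ρ : Measure ℝ) [IsProbabilityMeasure ρ] (u : ℝ) (b : Bool) :
    ρ.restrict (levelSet u b) = ρ (levelSet u b) • levelCond ρ u b := by
  unfold levelCond
  split_ifs with h
  · rw [Measure.restrict_eq_zero.2 h, h, zero_smul]
  · rw [ProbabilityTheory.cond, smul_smul, ENNReal.mul_inv_cancel h (measure_ne_top _ _), one_smul]

theorem setIntegral_levelSet {F : Type*} [NormedAddCommGroup F] [NormedSpace ℝ F]
    (ρ : Measure ℝ) [IsProbabilityMeasure ρ] (u : ℝ) (b : Bool) (f : ℝ → F) :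
    ∫ x in levelSet u b, f x ∂ρ = ρ.real (levelSet u b) • ∫ x, f x ∂(levelCond ρ u b) := by
  rw [restrict_levelSet, integral_smul_measure, measureReal_def]

theorem restrict_pi_levelSet (ρ : Measure ℝ) [IsProbabilityMeasure ρ] (u : ℝ) {n : ℕ}
    (β : Fin n → Bool) :
    (Measure.pi fun _ : Fin n => ρ).restrict (Set.univ.pi fun i => levelSet u (β i)) =
      (∏ i, ρ (levelSet u (β i))) • Measure.pi fun i => levelCond ρ u (β i) := by
  rw [Measure.restrict_pi_pi]
  refine Measure.pi_eq fun s hs => ?_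
  rw [Measure.smul_apply, Measure.pi_pi, smul_eq_mul, ← Finset.prod_mul_distrib]
  refine Finset.prod_congr rfl fun i _ => ?_
  rw [restrict_levelSet, Measure.smul_apply, smul_eq_mul]

theorem mem_pi_levelSet_iff {u : ℝ} {n : ℕ} {β : Fin n → Bool} {y : Fin n → ℝ} :
    (y ∈ Set.univ.pi fun i => levelSet u (β i)) ↔ (fun i => decide (u < y i)) = β := by
  simp only [Set.mem_univ_pi, funext_iff]
  refine forall_congr' fun i => ?_
  cases β i <;> simp [levelSet]

/-- Decomposition of an integral over independent variables according to the set of exceedances. -/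
theorem integral_pi_eq_sum_levelCond (ρ : Measure ℝ) [IsProbabilityMeasure ρ] (u : ℝ) {n : ℕ}
    {F : (Fin n → Bool) → (Fin n → ℝ) → ℝ} (hF : ∀ β, Measurable (F β)) {C : ℝ}
    (hC : ∀ β y, |F β y| ≤ C) :
    ∫ y, F (fun i => decide (u < y i)) y ∂(Measure.pi fun _ : Fin n => ρ) =
      ∑ β, (∏ i, bernoulliWeight (ρ.real (Set.Ioi u)) (β i)) *
        ∫ y, F β y ∂(Measure.pi fun i => levelCond ρ u (β i)) := by
  have hbox : ∀ β : Fin n → Bool, MeasurableSet (Set.univ.pi fun i => levelSet u (β i)) :=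
    fun β => MeasurableSet.univ_pi fun i => measurableSet_levelSet u (β i)
  have hpt : ∀ y, F (fun i => decide (u < y i)) y =
      ∑ β, (Set.univ.pi fun i => levelSet u (β i)).indicator (F β) y := by
    intro y
    rw [Finset.sum_eq_single fun i => decide (u < y i)]
    · rw [Set.indicator_of_mem (mem_pi_levelSet_iff.2 rfl)]
    · intro β _ hβ
      exact Set.indicator_of_notMem (fun h => hβ (mem_pi_levelSet_iff.1 h).symm) _
    · simp
  have hint : ∀ β, Integrable (F β) (Measure.pi fun _ : Fin n => ρ) := fun β =>
    Integrable.of_bound (hF β).aestronglyMeasurable C (ae_of_all _ (hC β))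
  simp_rw [hpt]
  rw [integral_finsetSum _ fun β _ => (hint β).indicator (hbox β)]
  refine Finset.sum_congr rfl fun β _ => ?_
  rw [integral_indicator (hbox β), restrict_pi_levelSet, integral_smul_measure, smul_eq_mul,
    ENNReal.toReal_prod]
  congr 1
  exact Finset.prod_congr rfl fun i _ => measureReal_levelSet ρ u (β i)

/-! ### Characteristic functions under conditioning -/

theorem charFun_eq_levelCond (ρ : Measure ℝ) [IsProbabilityMeasure ρ] (u s : ℝ) :
    charFun ρ s = ρ.real (Set.Ioi u) * charFun (levelCond ρ u true) s +
      (1 - ρ.real (Set.Ioi u)) * charFun (levelCond ρ u false) s := by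
  have hint : Integrable (fun x : ℝ => Complex.exp (s * x * Complex.I)) ρ := by
    refine Integrable.of_bound (C := 1) (by fun_prop) (ae_of_all _ fun x => ?_)
    rw [← Complex.ofReal_mul, Complex.norm_exp_ofReal_mul_I]
  have h := integral_add_compl (measurableSet_levelSet u true) hint
  have hc : (levelSet u true)ᶜ = levelSet u false := Set.compl_Ioi
  rw [hc, setIntegral_levelSet, setIntegral_levelSet, measureReal_levelSet,
    measureReal_levelSet] at h
  simp_rw [charFun_apply_real]
  rw [← h, Complex.real_smul, Complex.real_smul]
  simp [bernoulliWeight]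

theorem norm_charFun_sub_one_le (ρ : Measure ℝ) [IsProbabilityMeasure ρ]
    (hρ : Integrable (fun x => x) ρ) (s : ℝ) :
    ‖charFun ρ s - 1‖ ≤ |s| * ∫ x, |x| ∂ρ := by
  have hint : Integrable (fun x : ℝ => Complex.exp (s * x * Complex.I)) ρ := by
    refine Integrable.of_bound (C := 1) (by fun_prop) (ae_of_all _ fun x => ?_)
    rw [← Complex.ofReal_mul, Complex.norm_exp_ofReal_mul_I]
  have h1 : charFun ρ s - 1 = ∫ x, (Complex.exp (s * x * Complex.I) - 1) ∂ρ := by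
    rw [integral_sub hint (integrable_const _), charFun_apply_real]
    simp
  rw [h1, ← integral_const_mul]
  refine norm_integral_le_of_norm_le (hρ.abs.const_mul _) (ae_of_all _ fun x => ?_)
  have h2 := Real.norm_exp_I_mul_ofReal_sub_one_le (x := s * x)
  rwa [mul_comm, Complex.ofReal_mul, Real.norm_eq_abs, abs_mul] at h2

/-- This is the nonnegativity of the variance of `|x|`. -/
theorem sq_integral_abs_le (ρ : Measure ℝ) [IsProbabilityMeasure ρ]
    (hρ : MemLp (fun x => x) 2 ρ) : (∫ x, |x| ∂ρ) ^ 2 ≤ ∫ x, x ^ 2 ∂ρ := by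
  have h := variance_nonneg (fun x : ℝ => |x|) ρ
  have habs : MemLp (fun x : ℝ => |x|) 2 ρ := hρ.norm
  rw [variance_eq_sub habs] at h
  simpa [sq_abs] using h

/-- Factors are exchanged one at a time; the others have norm at most `1`. -/
theorem norm_prod_sub_prod_le {ι : Type*} (s : Finset ι) (a b : ι → ℂ) (ha : ∀ i, ‖a i‖ ≤ 1)
    (hb : ∀ i, ‖b i‖ ≤ 1) : ‖∏ i ∈ s, a i - ∏ i ∈ s, b i‖ ≤ ∑ i ∈ s, ‖a i - b i‖ := by
  classical
  induction s using Finset.induction_on with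
  | empty => simp
  | insert i s hi ih =>
    rw [Finset.prod_insert hi, Finset.prod_insert hi, Finset.sum_insert hi]
    have hsplit : a i * ∏ j ∈ s, a j - b i * ∏ j ∈ s, b j =
        (a i - b i) * ∏ j ∈ s, a j + b i * (∏ j ∈ s, a j - ∏ j ∈ s, b j) := by ring
    have hA : ‖∏ j ∈ s, a j‖ ≤ 1 := by
      rw [norm_prod]
      exact Finset.prod_le_one (fun _ _ => norm_nonneg _) fun j _ => ha j
    rw [hsplit]
    refine (norm_add_le _ _).trans ?_
    rw [norm_mul, norm_mul]
    gcongr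
    · exact mul_le_of_le_one_right (norm_nonneg _) hA
    · exact (mul_le_of_le_one_left (norm_nonneg _) (hb i)).trans ih

theorem tendsto_of_nat_mul_tendsto {p : ℕ → ℝ} {r : ℝ}
    (hp : Tendsto (fun n : ℕ => n * p n) atTop (𝓝 r)) : Tendsto p atTop (𝓝 0) := by
  have h := hp.div_atTop (tendsto_natCast_atTop_atTop (R := ℝ))
  refine h.congr' ?_
  filter_upwards [eventually_gt_atTop 0] with n hn
  field_simp

/-- An exceedance divided by `√n` tends to `0` in mean square: its second moment is the integral of
`x ^ 2` over `x > u n`, divided by `n * p n`. The denominator tends to `r > 0`. -/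
theorem tendsto_charFun_levelCond_true {ρ : Measure ℝ} [IsProbabilityMeasure ρ]
    (hsq : Integrable (fun x => x ^ 2) ρ) {u : ℕ → ℝ} {r : ℝ} (hr : 0 < r)
    (hu : Tendsto (fun n : ℕ => n * ρ.real (Set.Ioi (u n))) atTop (𝓝 r)) (t : ℝ) :
    Tendsto (fun n : ℕ => charFun (levelCond ρ (u n) true) ((√n)⁻¹ * t)) atTop (𝓝 1) := by
  have hp := tendsto_of_nat_mul_tendsto hu
  -- Absolute continuity of the integral suffices, as `p n → 0`; the levels themselves need not tend
  -- to infinity.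
  have hI : Tendsto (fun n => ∫ x in Set.Ioi (u n), x ^ 2 ∂ρ) atTop (𝓝 0) := by
    refine hsq.tendsto_setIntegral_nhds_zero ?_
    have h := ENNReal.tendsto_ofReal hp
    simpa [Function.comp_def] using h
  have hbound : Tendsto (fun n : ℕ => t ^ 2 * ((n * ρ.real (Set.Ioi (u n)))⁻¹ *
      ∫ x in Set.Ioi (u n), x ^ 2 ∂ρ)) atTop (𝓝 0) := by
    simpa using ((hu.inv₀ hr.ne').mul hI).const_mul (t ^ 2)
  rw [tendsto_iff_norm_sub_tendsto_zero]
  have hsqz : Tendsto (fun n : ℕ =>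
      ‖charFun (levelCond ρ (u n) true) ((√n)⁻¹ * t) - 1‖ ^ 2) atTop (𝓝 0) := by
    refine squeeze_zero' (Eventually.of_forall fun n => by positivity) ?_ hbound
    filter_upwards [hu.eventually (lt_mem_nhds hr), eventually_gt_atTop 0] with n hn hn0
    have hn' : (0 : ℝ) < n := by exact_mod_cast hn0
    have hpos : 0 < ρ.real (Set.Ioi (u n)) := pos_of_mul_pos_right hn hn'.le
    have hne : ρ (levelSet (u n) true) ≠ 0 := fun h0 => by
      have : ρ.real (Set.Ioi (u n)) = 0 := by
        rw [measureReal_def]; exact (congrArg ENNReal.toReal h0).trans (by simp)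
      exact hpos.ne' this
    have hL : MemLp (fun x : ℝ => x) 2 (levelCond ρ (u n) true) := by
      have h2 : MemLp (fun x : ℝ => x) 2 ρ := (memLp_two_iff_integrable_sq (by fun_prop)).2 hsq
      unfold levelCond
      rw [if_neg hne, ProbabilityTheory.cond]
      exact (h2.restrict _).smul_measure (ENNReal.inv_ne_top.2 hne)
    have hm := setIntegral_levelSet ρ (u n) true fun x => x ^ 2
    have hset : levelSet (u n) true = Set.Ioi (u n) := rfl
    rw [hset, smul_eq_mul] at hm
    calc ‖charFun (levelCond ρ (u n) true) ((√n)⁻¹ * t) - 1‖ ^ 2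
        ≤ (|(√n)⁻¹ * t| * ∫ x, |x| ∂(levelCond ρ (u n) true)) ^ 2 := by
          gcongr
          exact norm_charFun_sub_one_le _ (hL.integrable (by norm_num)) _
      _ = (n : ℝ)⁻¹ * t ^ 2 * (∫ x, |x| ∂(levelCond ρ (u n) true)) ^ 2 := by
          rw [mul_pow, sq_abs, mul_pow, inv_pow, Real.sq_sqrt hn'.le]
      _ ≤ (n : ℝ)⁻¹ * t ^ 2 * ∫ x, x ^ 2 ∂(levelCond ρ (u n) true) := by
          gcongr
          exact sq_integral_abs_le _ hL
      _ = _ := by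
          rw [hm]
          field_simp
  have h := hsqz.sqrt
  simpa [Real.sqrt_sq] using h

/-- Conditioning finitely many variables to exceed the levels does not change the limit of the
characteristic functions of the normalized sums. -/
theorem tendsto_prod_charFun_levelCond {ρ : Measure ℝ} [IsProbabilityMeasure ρ]
    (hmean : ∫ x, x ∂ρ = 0) (hvar : ∫ x, x ^ 2 ∂ρ = 1) {u : ℕ → ℝ} {r : ℝ}
    (hu : Tendsto (fun n : ℕ => n * ρ.real (Set.Ioi (u n))) atTop (𝓝 r))
    {β : ∀ n, Fin n → Bool} {k : ℕ}
    (hβ : ∀ᶠ n in atTop, (Finset.univ.filter fun i => β n i = true).card = k)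
    (hk : k = 0 ∨ r ≠ 0) (t : ℝ) :
    Tendsto (fun n : ℕ => ∏ i, charFun (levelCond ρ (u n) (β n i)) ((√n)⁻¹ * t)) atTop
      (𝓝 (Complex.exp (-t ^ 2 / 2))) := by
  have hsq : Integrable (fun x => x ^ 2) ρ := by
    by_contra h
    rw [integral_undef h] at hvar
    exact zero_ne_one hvar
  have hs : Tendsto (fun n : ℕ => (√n)⁻¹ * t) atTop (𝓝 0) := by
    simpa using (tendsto_inv_atTop_zero.comp
      (Real.tendsto_sqrt_atTop.comp tendsto_natCast_atTop_atTop)).mul_const t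
  set p : ℕ → ℝ := fun n => ρ.real (Set.Ioi (u n)) with hp_def
  set φ : ℕ → ℂ := fun n => charFun ρ ((√n)⁻¹ * t) with hφ_def
  set ψ : Bool → ℕ → ℂ := fun b n => charFun (levelCond ρ (u n) b) ((√n)⁻¹ * t) with hψ_def
  have hp0 : ∀ n, 0 ≤ p n := fun n => measureReal_nonneg
  have hr0 : 0 ≤ r := ge_of_tendsto' hu fun n => mul_nonneg n.cast_nonneg (hp0 n)
  have hφpow : Tendsto (fun n => φ n ^ n) atTop (𝓝 (Complex.exp (-t ^ 2 / 2))) := by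
    have h := tendsto_charFun_inv_sqrt_mul_pow (P := ρ) (X := fun x => x) aemeasurable_id hmean
      (by simpa using hvar) t
    simpa using h
  have hφ1 : Tendsto φ atTop (𝓝 1) := by
    have h : Tendsto φ atTop (𝓝 (charFun ρ 0)) :=
      (continuous_charFun (μ := ρ)).tendsto 0 |>.comp hs
    simpa using h
  have hψ1 : ∀ b n, ‖ψ b n‖ ≤ 1 := fun b n => norm_charFun_le_one _
  have hφψ : ∀ n, φ n = p n * ψ true n + (1 - p n) * ψ false n :=
    fun n => charFun_eq_levelCond ρ (u n) _
  -- Since `φ` is the mixture of both conditional functions, conditioning to be small costs a factor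
  -- `p n`.
  have hfalse : ∀ n, ‖ψ false n - φ n‖ = p n * ‖ψ true n - ψ false n‖ := by
    intro n
    have : ψ false n - φ n = (p n : ℂ) * -(ψ true n - ψ false n) := by rw [hφψ]; ring
    rw [this, norm_mul, norm_neg, Complex.norm_real, Real.norm_of_nonneg (hp0 n)]
  have hdiff2 : ∀ n, ‖ψ true n - ψ false n‖ ≤ 2 := fun n =>
    (norm_sub_le _ _).trans (by linarith [hψ1 true n, hψ1 false n])
  have htrue : r ≠ 0 → Tendsto (ψ true) atTop (𝓝 1) := fun hr =>
    tendsto_charFun_levelCond_true hsq (lt_of_le_of_ne hr0 hr.symm) hu t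
  have hfalse0 : Tendsto (fun n => ψ false n - φ n) atTop (𝓝 0) := by
    rw [tendsto_zero_iff_norm_tendsto_zero]
    refine squeeze_zero (fun n => norm_nonneg _) (fun n => ?_)
      (by simpa using (tendsto_of_nat_mul_tendsto hu).mul_const 2)
    rw [hfalse]
    exact mul_le_mul_of_nonneg_left (hdiff2 n) (hp0 n)
  have hA : Tendsto (fun n : ℕ => (n : ℝ) * ‖ψ false n - φ n‖) atTop (𝓝 0) := by
    simp_rw [hfalse, ← mul_assoc]
    -- For `r = 0` the factor `n * p n` vanishes by itself. Otherwise it is only bounded, and the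
    -- convergence of `ψ true` and `ψ false` to the common limit `1` is used.
    by_cases hr : r = 0
    · subst hr
      refine squeeze_zero (fun n => by have := hp0 n; positivity) (fun n => ?_)
        (by simpa using hu.mul_const 2)
      exact mul_le_mul_of_nonneg_left (hdiff2 n) (mul_nonneg n.cast_nonneg (hp0 n))
    · have h1 : Tendsto (fun n => ψ true n - ψ false n) atTop (𝓝 0) := by
        have h := (htrue hr).sub (hfalse0.add hφ1)
        simpa using h
      simpa using hu.mul h1.norm
  have hB : Tendsto (fun n : ℕ => (k : ℝ) * ‖ψ true n - φ n‖) atTop (𝓝 0) := by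
    rcases hk with rfl | hr
    · simp
    · simpa using (((htrue hr).sub hφ1).norm).const_mul (k : ℝ)
  have hdiff : Tendsto (fun n => ∏ i, ψ (β n i) n - φ n ^ n) atTop (𝓝 0) := by
    refine squeeze_zero_norm' ?_ (by simpa using hA.add hB)
    filter_upwards [hβ] with n hn
    have h := norm_prod_sub_prod_le (Finset.univ : Finset (Fin n)) (fun i => ψ (β n i) n)
      (fun _ => φ n) (fun i => hψ1 _ _) (fun _ => norm_charFun_le_one _)
    rw [Finset.prod_const, Finset.card_univ, Fintype.card_fin] at h
    refine h.trans ?_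
    -- Summed over `i`, this gives at most `n` small terms for unmarked indices and exactly `k` for
    -- marked ones.
    have hi : ∀ i, ‖ψ (β n i) n - φ n‖ ≤ ‖ψ false n - φ n‖ +
        if β n i = true then ‖ψ true n - φ n‖ else 0 := by
      intro i
      cases β n i <;> simp
    refine (Finset.sum_le_sum fun i _ => hi i).trans_eq ?_
    rw [Finset.sum_add_distrib, ← Finset.sum_filter, Finset.sum_const, Finset.sum_const, hn]
    simp
  simpa using hdiff.add hφpow

/-! ### Weak convergence of the normalized sums -/

/-- The law of `(∑ i, y i) / √n` for independent `y i` with laws `ν i`. -/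
noncomputable def normalizedSumLaw {n : ℕ} (ν : Fin n → Measure ℝ) : Measure ℝ :=
  (Measure.pi ν).map fun y => (∑ i, y i) / √(n : ℝ)

instance {n : ℕ} (ν : Fin n → Measure ℝ) [∀ i, IsProbabilityMeasure (ν i)] :
    IsProbabilityMeasure (normalizedSumLaw ν) :=
  Measure.isProbabilityMeasure_map (by fun_prop)

theorem charFun_normalizedSumLaw {n : ℕ} (ν : Fin n → Measure ℝ)
    [∀ i, IsProbabilityMeasure (ν i)] (t : ℝ) :
    charFun (normalizedSumLaw ν) t = ∏ i, charFun (ν i) ((√n)⁻¹ * t) := by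
  have h : (fun y : Fin n → ℝ => (∑ i, y i) / √(n : ℝ)) = fun y => (√n)⁻¹ * ∑ i, y i := by
    ext y; rw [div_eq_inv_mul]
  rw [normalizedSumLaw, h, charFun_map_mul_comp (by fun_prop), charFun_map_sum_pi_eq_prod,
    Finset.prod_apply]

theorem integral_normalizedSumLaw {n : ℕ} (ν : Fin n → Measure ℝ) {f : ℝ → ℝ}
    (hf : Continuous f) :
    ∫ s, f s ∂(normalizedSumLaw ν) = ∫ y, f ((∑ i, y i) / √(n : ℝ)) ∂(Measure.pi ν) :=
  integral_map (by fun_prop) hf.aestronglyMeasurable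

theorem tendsto_normalizedSumLaw_of_charFun {ν : ∀ n, Fin n → Measure ℝ}
    [∀ n i, IsProbabilityMeasure (ν n i)]
    (h : ∀ t : ℝ, Tendsto (fun n : ℕ => ∏ i, charFun (ν n i) ((√n)⁻¹ * t)) atTop
      (𝓝 (Complex.exp (-t ^ 2 / 2)))) :
    Tendsto (β := ProbabilityMeasure ℝ) (fun n => ⟨normalizedSumLaw (ν n), inferInstance⟩) atTop
      (𝓝 ⟨gaussianReal 0 1, inferInstance⟩) := by
  refine ProbabilityMeasure.tendsto_of_tendsto_charFun fun t => ?_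
  simp only [ProbabilityMeasure.coe_mk, charFun_normalizedSumLaw, charFun_gaussianReal]
  simpa [neg_div] using h t

/-- Weak convergence of the second factor and convergence of the first one are enough to integrate
a bounded continuous function of two variables. -/
theorem tendsto_integral_of_tendsto_of_tendsto {E : Type*} [TopologicalSpace E]
    (f : (E × ℝ) →ᵇ ℝ) {m : ℕ → E} {m₀ : E} (hm : Tendsto m atTop (𝓝 m₀))
    {κ : ℕ → ProbabilityMeasure ℝ} {κ₀ : ProbabilityMeasure ℝ} (hκ : Tendsto κ atTop (𝓝 κ₀)) :
    Tendsto (fun n => ∫ s, f (m n, s) ∂(κ n : Measure ℝ)) atTop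
      (𝓝 (∫ s, f (m₀, s) ∂(κ₀ : Measure ℝ))) := by
  have hcont : ∀ e, Continuous fun s => f (e, s) := fun e =>
    f.continuous.comp (Continuous.prodMk_right e)
  have hint : ∀ (e : E) (ν : ProbabilityMeasure ℝ), Integrable (fun s => f (e, s)) (ν : Measure ℝ) :=
    fun e ν => Integrable.of_bound (hcont e).aestronglyMeasurable ‖f‖
      (ae_of_all _ fun s => f.norm_coe_le_norm _)
  have hfix : Tendsto (fun n => ∫ s, f (m₀, s) ∂(κ n : Measure ℝ)) atTop
      (𝓝 (∫ s, f (m₀, s) ∂(κ₀ : Measure ℝ))) :=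
    (ProbabilityMeasure.tendsto_iff_forall_integral_tendsto.1 hκ)
      (BoundedContinuousFunction.ofNormedAddCommGroup (fun s => f (m₀, s)) (hcont m₀) ‖f‖
        fun s => f.norm_coe_le_norm _)
  -- Off a compact set of `s` the mass is small uniformly in `n`; on it `f (e, s)` is close to `f
  -- (m₀, s)`, uniformly in `s`, for `e` near `m₀`.
  have htight : IsTightMeasureSet {((κ n : ProbabilityMeasure ℝ) : Measure ℝ) | n} :=
    isTightMeasureSet_of_tendsto_charFun (f := charFun (κ₀ : Measure ℝ))
      continuous_charFun.continuousAt (ProbabilityMeasure.tendsto_iff_tendsto_charFun.1 hκ)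
  have hdiff : Tendsto (fun n => ∫ s, f (m n, s) ∂(κ n : Measure ℝ) -
      ∫ s, f (m₀, s) ∂(κ n : Measure ℝ)) atTop (𝓝 0) := by
    rw [Metric.tendsto_nhds]
    intro ε hε
    set M := 2 * ‖f‖ with hM
    have hM0 : 0 ≤ M := by positivity
    -- `M` bounds the integrand, so the part off `K` costs at most `ε / 4`; the `+ 1` covers `M =
    -- 0`.
    obtain ⟨K, hK, hKκ⟩ := isTightMeasureSet_iff_exists_isCompact_measure_compl_le.1 htight
      (ENNReal.ofReal (ε / (4 * (M + 1)))) (by simpa using by positivity)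
    have hunif : ∀ᶠ e in 𝓝 m₀, ∀ s ∈ K, |f (e, s) - f (m₀, s)| < ε / 2 := by
      refine hK.eventually_forall_of_forall_eventually fun s _ => ?_
      have hc : Continuous fun z : E × ℝ => |f (z.1, z.2) - f (m₀, z.2)| := by fun_prop
      refine hc.continuousAt.eventually_lt continuousAt_const ?_
      simpa using hε
    filter_upwards [hm.eventually hunif] with n hn
    have hKn : (κ n : Measure ℝ).real Kᶜ ≤ ε / (4 * (M + 1)) :=
      ENNReal.toReal_le_of_le_ofReal (by positivity) (hKκ _ ⟨n, rfl⟩)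
    have hind : Integrable (fun s => ε / 2 + Kᶜ.indicator (fun _ => M) s) (κ n : Measure ℝ) :=
      (integrable_const _).add ((integrable_const _).indicator hK.measurableSet.compl)
    rw [← integral_sub (hint _ _) (hint _ _), dist_zero_right]
    have hle : ‖∫ s, (f (m n, s) - f (m₀, s)) ∂(κ n : Measure ℝ)‖ ≤
        ∫ s, (ε / 2 + Kᶜ.indicator (fun _ => M) s) ∂(κ n : Measure ℝ) := by
      refine norm_integral_le_of_norm_le hind (ae_of_all _ fun s => ?_)
      rw [Real.norm_eq_abs]
      by_cases hs : s ∈ K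
      · simpa [hs] using (hn s hs).le
      · have h1 := f.norm_coe_le_norm (m n, s)
        have h2 := f.norm_coe_le_norm (m₀, s)
        have h3 := norm_sub_le (f (m n, s)) (f (m₀, s))
        rw [Real.norm_eq_abs (_ - _)] at h3
        rw [Set.indicator_of_mem (by exact hs)]
        linarith
    refine hle.trans_lt ?_
    rw [integral_add (integrable_const _) ((integrable_const _).indicator hK.measurableSet.compl),
      integral_indicator_const _ hK.measurableSet.compl]
    have hlt : (κ n : Measure ℝ).real Kᶜ * M ≤ ε / 4 := by
      refine (mul_le_mul_of_nonneg_right hKn hM0).trans ?_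
      rw [div_mul_eq_mul_div, div_le_div_iff₀ (by positivity) (by norm_num)]
      nlinarith
    simp only [integral_const, probReal_univ, smul_eq_mul]
    linarith
  simpa using hdiff.add hfix

/-! ### Application to the sequence of variables -/

theorem exceedanceProcess_eq_markedPointMeasure {Ω : Type*} (X : ℕ → Ω → ℝ) (u : ℕ → ℝ) (n : ℕ)
    (ω : Ω) : exceedanceProcess X u n ω =
      markedPointMeasure n fun i => decide (u n < X i ω) := by
  simp [exceedanceProcess, markedPointMeasure]

theorem map_fin_eq_pi {Ω : Type*} [MeasurableSpace Ω] {μ : Measure Ω} [IsProbabilityMeasure μ]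
    {X : ℕ → Ω → ℝ} (hX_meas : ∀ i, Measurable (X i)) (hX_indep : iIndepFun X μ)
    (hX_ident : ∀ i, IdentDistrib (X i) (X 0) μ μ) (n : ℕ) :
    μ.map (fun ω (i : Fin n) => X i ω) = Measure.pi fun _ => μ.map (X 0) := by
  have h : iIndepFun (fun i : Fin n => X i) μ := hX_indep.precomp Fin.val_injective
  rw [(iIndepFun_iff_map_fun_eq_pi_map fun i : Fin n => (hX_meas i).aemeasurable).1 h]
  congr 1
  ext1 i
  exact (hX_ident i).map_eq

/-- If `(1 - p n) ^ n` has a positive limit `c`, then `n * p n` tends to `- log c`. -/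
theorem tendsto_nat_mul_of_tendsto_one_sub_pow {p : ℕ → ℝ} (hp1 : ∀ n, p n ≤ 1) {c : ℝ}
    (hc : 0 < c) (h : Tendsto (fun n => (1 - p n) ^ n) atTop (𝓝 c)) :
    Tendsto (fun n => n * p n) atTop (𝓝 (-Real.log c)) := by
  -- With `y n = -log ((1 - p n) ^ n)` one has `exp (-y n / n) = 1 - p n`, so `n * (1 - exp (-y n /
  -- n))` is `n * p n`.
  have hy : Tendsto (fun n => -Real.log ((1 - p n) ^ n)) atTop (𝓝 (-Real.log c)) :=
    (h.log hc.ne').neg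
  refine (tendsto_nat_mul_one_sub_exp hy).congr' ?_
  filter_upwards [h.eventually (lt_mem_nhds hc), eventually_gt_atTop 0] with n hn hn0
  have hn' : (n : ℝ) ≠ 0 := by exact_mod_cast hn0.ne'
  have hpos : 0 < 1 - p n := by
    refine lt_of_le_of_ne (sub_nonneg.2 (hp1 n)) fun h0 => ?_
    rw [← h0, zero_pow hn0.ne'] at hn
    exact lt_irrefl _ hn
  rw [Real.log_pow, neg_div, neg_neg, mul_div_cancel_left₀ _ hn', Real.exp_log hpos,
    sub_sub_cancel]

theorem measureReal_partialMax_le {Ω : Type*} [MeasurableSpace Ω] {μ : Measure Ω}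
    [IsProbabilityMeasure μ] {X : ℕ → Ω → ℝ} (hX_meas : ∀ i, Measurable (X i))
    (hX_indep : iIndepFun X μ) (hX_ident : ∀ i, IdentDistrib (X i) (X 0) μ μ) {n : ℕ}
    (hn : 0 < n) (u : ℝ) :
    μ.real {ω | partialMax X n ω ≤ u} = (1 - (μ.map (X 0)).real (Set.Ioi u)) ^ n := by
  have : IsProbabilityMeasure (μ.map (X 0)) :=
    Measure.isProbabilityMeasure_map (hX_meas 0).aemeasurable
  have : Nonempty (Fin n) := ⟨⟨0, hn⟩⟩
  have hset : {ω | partialMax X n ω ≤ u} =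
      (fun ω (i : Fin n) => X i ω) ⁻¹' Set.univ.pi fun _ => Set.Iic u := by
    ext ω
    simp [partialMax, ciSup_le_iff (Set.finite_range _).bddAbove, Pi.le_def]
  rw [hset, measureReal_def, ← Measure.map_apply (measurable_pi_lambda _ fun i : Fin n => hX_meas i)
    (MeasurableSet.univ_pi fun _ => measurableSet_Iic), map_fin_eq_pi hX_meas hX_indep hX_ident,
    Measure.pi_pi, ENNReal.toReal_prod, Finset.prod_const, Finset.card_univ, Fintype.card_fin,
    ← measureReal_def]
  have h := measureReal_levelSet (μ.map (X 0)) u false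
  have hs : levelSet u false = Set.Iic u := rfl
  rw [hs] at h
  rw [h]
  simp [bernoulliWeight]

theorem tendsto_nat_mul_measureReal_Ioi {Ω : Type*} [MeasurableSpace Ω] {μ : Measure Ω}
    [IsProbabilityMeasure μ] {X : ℕ → Ω → ℝ} (hX_meas : ∀ i, Measurable (X i))
    (hX_indep : iIndepFun X μ) (hX_ident : ∀ i, IdentDistrib (X i) (X 0) μ μ)
    {a b : ℕ → ℝ} (ha : ∀ n, 1 ≤ n → 0 < a n) {x c : ℝ} (hc : 0 < c)
    (hlim : Tendsto (fun n => μ.real {ω | a n * (partialMax X n ω - b n) ≤ x}) atTop (𝓝 c)) :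
    Tendsto (fun n : ℕ => n * (μ.map (X 0)).real (Set.Ioi (x / a n + b n))) atTop
      (𝓝 (-Real.log c)) := by
  have : IsProbabilityMeasure (μ.map (X 0)) :=
    Measure.isProbabilityMeasure_map (hX_meas 0).aemeasurable
  refine tendsto_nat_mul_of_tendsto_one_sub_pow (fun n => measureReal_le_one) hc
    (hlim.congr' ?_)
  filter_upwards [eventually_gt_atTop 0] with n hn
  rw [← measureReal_partialMax_le hX_meas hX_indep hX_ident hn]
  congr 1
  ext ω
  simp only [Set.mem_ofPred_eq]
  rw [← sub_le_iff_le_add, le_div_iff₀' (ha n hn)]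

theorem measurable_decide_lt {Ω ι : Type*} [MeasurableSpace Ω] {Y : ι → Ω → ℝ}
    (hY : ∀ i, Measurable (Y i)) (u : ℝ) : Measurable fun ω (i : ι) => decide (u < Y i ω) := by
  refine measurable_pi_lambda _ fun i => measurable_to_bool (f := fun ω => decide (u < Y i ω)) ?_
  have hs : (fun ω => decide (u < Y i ω)) ⁻¹' {true} = {ω | u < Y i ω} := by
    ext ω; simp
  rw [hs]
  exact measurableSet_lt measurable_const (hY i)

/-- The mean of a function of the marked exceedances and of the normalized sum. -/
theorem integral_exceedance_eq_sum {Ω : Type*} [MeasurableSpace Ω] {μ : Measure Ω}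
    [IsProbabilityMeasure μ] {X : ℕ → Ω → ℝ} (hX_meas : ∀ i, Measurable (X i))
    (hX_indep : iIndepFun X μ) (hX_ident : ∀ i, IdentDistrib (X i) (X 0) μ μ) (n : ℕ) (u : ℝ)
    {F : (Fin n → Bool) → ℝ → ℝ} (hF : ∀ β, Continuous (F β)) {C : ℝ}
    (hC : ∀ β s, |F β s| ≤ C) :
    ∫ ω, F (fun i => decide (u < X i ω)) (partialSum X n ω / √(n : ℝ)) ∂μ =
      ∑ β, (∏ i, bernoulliWeight ((μ.map (X 0)).real (Set.Ioi u)) (β i)) *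
        ∫ s, F β s ∂(normalizedSumLaw fun i => levelCond (μ.map (X 0)) u (β i)) := by
  have : IsProbabilityMeasure (μ.map (X 0)) :=
    Measure.isProbabilityMeasure_map (hX_meas 0).aemeasurable
  simp_rw [fun β => integral_normalizedSumLaw
    (fun i => levelCond (μ.map (X 0)) u (β i)) (hF β)]
  rw [← integral_pi_eq_sum_levelCond (μ.map (X 0)) u
    (F := fun β y => F β ((∑ i, y i) / √(n : ℝ)))
    (fun β => (hF β).measurable.comp (by fun_prop)) (fun β y => hC β _),
    ← map_fin_eq_pi hX_meas hX_indep hX_ident, integral_map]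
  · rfl
  · exact (measurable_pi_lambda _ fun i : Fin n => hX_meas i).aemeasurable
  · have hm : Measurable fun q : (Fin n → Bool) × ℝ => F q.1 q.2 :=
      measurable_from_prod_countable_right fun β => (hF β).measurable
    exact (hm.comp (Measurable.prodMk (measurable_decide_lt measurable_pi_apply u)
      (by fun_prop))).aestronglyMeasurable

theorem integral_partialSum {Ω : Type*} [MeasurableSpace Ω] {μ : Measure Ω}
    [IsProbabilityMeasure μ] {X : ℕ → Ω → ℝ} (hX_meas : ∀ i, Measurable (X i))
    (hX_indep : iIndepFun X μ) (hX_ident : ∀ i, IdentDistrib (X i) (X 0) μ μ) (n : ℕ)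
    {f : ℝ → ℝ} (hf : Continuous f) :
    ∫ ω, f (partialSum X n ω / √(n : ℝ)) ∂μ =
      ∫ s, f s ∂(normalizedSumLaw fun _ : Fin n => μ.map (X 0)) := by
  rw [integral_normalizedSumLaw _ hf, ← map_fin_eq_pi hX_meas hX_indep hX_ident, integral_map
    (measurable_pi_lambda _ fun i : Fin n => hX_meas i).aemeasurable (by fun_prop)]
  rfl

/-- Convergence of the exceedance process to a Poisson process. -/
theorem tendstoInLaw_exceedanceProcess {Ω : Type*} [MeasurableSpace Ω] {μ : Measure Ω}
    [IsProbabilityMeasure μ] {X : ℕ → Ω → ℝ} (hX_meas : ∀ i, Measurable (X i))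
    (hX_indep : iIndepFun X μ) (hX_ident : ∀ i, IdentDistrib (X i) (X 0) μ μ)
    {u : ℕ → ℝ} {r : ℝ≥0}
    (hu : Tendsto (fun n : ℕ => n * (μ.map (X 0)).real (Set.Ioi (u n))) atTop (𝓝 r)) :
    TendstoInLaw (exceedanceProcess X u) samplePointMeasure μ
      (poissonSampleMeasure r (lebesgueIoc : Measure (Set.Ioc (0 : ℝ) 1))) := by
  have : IsProbabilityMeasure (μ.map (X 0)) :=
    Measure.isProbabilityMeasure_map (hX_meas 0).aemeasurable
  unfold TendstoInLaw
  let _ : MeasurableSpace (FiniteMeasure (Set.Ioc (0 : ℝ) 1)) := borel _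
  have _ : BorelSpace (FiniteMeasure (Set.Ioc (0 : ℝ) 1)) := ⟨rfl⟩
  have hmeas : ∀ n, Measurable (exceedanceProcess X u n) := by
    intro n
    have h := (measurable_of_finite (markedPointMeasure n)).comp
      (measurable_decide_lt (fun i : Fin n => hX_meas i) (u n))
    have heq : exceedanceProcess X u n =
        markedPointMeasure n ∘ fun ω i => decide (u n < X i ω) :=
      funext (exceedanceProcess_eq_markedPointMeasure X u n)
    rwa [heq]
  have hN : Measurable (samplePointMeasure (E := Set.Ioc (0 : ℝ) 1)) :=
    measurable_borel_samplePointMeasure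
  refine ⟨fun n => (hmeas n).aemeasurable, hN.aemeasurable, ?_⟩
  refine ProbabilityMeasure.tendsto_iff_forall_integral_tendsto.2 fun f => ?_
  have hlim := tendsto_sum_prod_bernoulliWeight_mul (fun n => measureReal_nonneg)
    (fun n => measureReal_le_one) hu (h := fun n β => f (markedPointMeasure n β)) (C := ‖f‖)
    -- Along the occupancies of a sample with distinct points, the integrands converge by continuity
    -- of `f`.
    (fun n β => f.norm_coe_le_norm _) (g := fun ω => f (samplePointMeasure ω)) (by
      filter_upwards [ae_injective_poissonSampleMeasure r
        (lebesgueIoc : Measure (Set.Ioc (0 : ℝ) 1))] with ω hω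
      exact (f.continuous.tendsto _).comp (tendsto_markedPointMeasure_occupancy hω))
  simp only [ProbabilityMeasure.coe_mk]
  rw [integral_map hN.aemeasurable f.continuous.measurable.aestronglyMeasurable]
  refine hlim.congr fun n => ?_
  rw [integral_map (hmeas n).aemeasurable f.continuous.measurable.aestronglyMeasurable]
  have h := integral_exceedance_eq_sum hX_meas hX_indep hX_ident n (u n)
    (F := fun β _ => f (markedPointMeasure n β)) (fun β => continuous_const) (C := ‖f‖)
    (fun β s => f.norm_coe_le_norm _)
  simp only [integral_const, probReal_univ, one_smul] at h
  simp_rw [exceedanceProcess_eq_markedPointMeasure]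
  exact h.symm

/-- Asymptotic independence of the exceedance process and the normalized sums. -/
theorem asymptoticallyIndependent_exceedanceProcess {Ω : Type*} [MeasurableSpace Ω]
    {μ : Measure Ω} [IsProbabilityMeasure μ] {X : ℕ → Ω → ℝ} (hX_meas : ∀ i, Measurable (X i))
    (hX_indep : iIndepFun X μ) (hX_ident : ∀ i, IdentDistrib (X i) (X 0) μ μ)
    (hX_mean : ∫ ω, X 0 ω ∂μ = 0) (hX_sq : ∫ ω, X 0 ω ^ 2 ∂μ = 1) {u : ℕ → ℝ} {r : ℝ≥0}
    (hu : Tendsto (fun n : ℕ => n * (μ.map (X 0)).real (Set.Ioi (u n))) atTop (𝓝 r)) :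
    AsymptoticallyIndependent (exceedanceProcess X u)
      (fun n ω => partialSum X n ω / √(n : ℝ)) μ := by
  intro f
  set ρ := μ.map (X 0) with hρ_def
  have : IsProbabilityMeasure ρ := Measure.isProbabilityMeasure_map (hX_meas 0).aemeasurable
  have hmean : ∫ x, x ∂ρ = 0 := by
    rw [hρ_def, integral_map (hX_meas 0).aemeasurable (by fun_prop), hX_mean]
  have hvar : ∫ x, x ^ 2 ∂ρ = 1 := by
    rw [hρ_def, integral_map (hX_meas 0).aemeasurable (by fun_prop), hX_sq]
  have hcont : ∀ m, Continuous fun s => f (m, s) := fun m =>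
    f.continuous.comp (Continuous.prodMk_right m)
  have hsum : Tendsto (β := ProbabilityMeasure ℝ)
      (fun n => ⟨normalizedSumLaw fun _ : Fin n => ρ, inferInstance⟩) atTop
      (𝓝 ⟨gaussianReal 0 1, inferInstance⟩) := by
    refine tendsto_normalizedSumLaw_of_charFun fun t => ?_
    have h := tendsto_charFun_inv_sqrt_mul_pow (P := ρ) (X := fun x => x) aemeasurable_id hmean
      (by simpa using hvar) t
    simpa using h
  have hbound : ∀ (m : FiniteMeasure (Set.Ioc (0 : ℝ) 1)) (κ : Measure ℝ)
      [IsProbabilityMeasure κ], |∫ s, f (m, s) ∂κ| ≤ ‖f‖ := by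
    intro m κ _
    have h := norm_integral_le_of_norm_le_const (μ := κ)
      (ae_of_all _ fun s => f.norm_coe_le_norm (m, s))
    simpa using h
  have hlim := tendsto_sum_prod_bernoulliWeight_mul (fun n => measureReal_nonneg)
    (fun n => measureReal_le_one) hu
    -- The integrand compares the law of the normalized sum given the marks with its unconditional
    -- law. Both have the same Gaussian limit along the occupancies, so the difference tends to `0`.
    (h := fun n β =>
      ∫ s, f (markedPointMeasure n β, s) ∂(normalizedSumLaw fun i => levelCond ρ (u n) (β i)) -
      ∫ s, f (markedPointMeasure n β, s) ∂(normalizedSumLaw fun _ : Fin n => ρ))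
    (C := 2 * ‖f‖)
    (fun n β => (abs_sub _ _).trans (by
      rw [two_mul]; exact add_le_add (hbound _ _) (hbound _ _))) (g := fun _ => 0) (by
      have hzero : ∀ᵐ ω ∂(poissonSampleMeasure r (lebesgueIoc : Measure (Set.Ioc (0 : ℝ) 1))),
          ω.1 = 0 ∨ (r : ℝ) ≠ 0 := by
        by_cases hr : r = 0
        · subst hr
          filter_upwards [ae_fst_eq_zero_poissonSampleMeasure
            (lebesgueIoc : Measure (Set.Ioc (0 : ℝ) 1))] with ω hω using Or.inl hω
        · exact ae_of_all _ fun ω => Or.inr (by exact_mod_cast hr)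
      filter_upwards [ae_injective_poissonSampleMeasure r
        (lebesgueIoc : Measure (Set.Ioc (0 : ℝ) 1)), hzero] with ω hω hω0
      have hm := tendsto_markedPointMeasure_occupancy hω
      have hκ := tendsto_normalizedSumLaw_of_charFun
        (ν := fun n i => levelCond ρ (u n) (occupancy n ω i))
        (tendsto_prod_charFun_levelCond hmean hvar hu (eventually_card_occupancy hω) hω0)
      have h := (tendsto_integral_of_tendsto_of_tendsto f hm hκ).sub
        (tendsto_integral_of_tendsto_of_tendsto f hm hsum)
      rw [sub_self] at h
      exact h)
  rw [integral_zero] at hlim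
  refine hlim.congr fun n => ?_
  simp_rw [mul_sub, Finset.sum_sub_distrib]
  congr 1
  · have h := integral_exceedance_eq_sum hX_meas hX_indep hX_ident n (u n)
      (F := fun β s => f (markedPointMeasure n β, s)) (fun β => hcont _) (C := ‖f‖)
      (fun β s => f.norm_coe_le_norm _)
    simp_rw [exceedanceProcess_eq_markedPointMeasure]
    exact h.symm
  -- For the product of the two laws, the inner integral depends on the marks alone, so conditioning
  -- leaves it unchanged.
  · have h := integral_exceedance_eq_sum hX_meas hX_indep hX_ident n (u n)
      (F := fun β _ => ∫ s, f (markedPointMeasure n β, s) ∂(normalizedSumLaw fun _ : Fin n => ρ))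
      (fun β => continuous_const) (C := ‖f‖) (fun β s => hbound _ _)
    simp only [integral_const, probReal_univ, one_smul] at h
    simp_rw [exceedanceProcess_eq_markedPointMeasure,
      integral_partialSum hX_meas hX_indep hX_ident n (hcont _)]
    exact h.symm

theorem theorem2p1 {Ω : Type*} [MeasurableSpace Ω] (μ : Measure Ω) [IsProbabilityMeasure μ]
    (X : ℕ → Ω → ℝ) (hX_meas : ∀ i, Measurable (X i)) (hX_indep : iIndepFun X μ)
    (hX_ident : ∀ i, IdentDistrib (X i) (X 0) μ μ)
    (hX_mean : ∫ ω, X 0 ω ∂μ = 0) (hX_sq : ∫ ω, X 0 ω ^ 2 ∂μ = 1)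
    (G : ℝ → ℝ) (hG : IsAdmissibleExtremeValueCDF G)
    (a b : ℕ → ℝ) (ha : ∀ n, 1 ≤ n → 0 < a n)
    (hlim : ∀ t : ℝ, Tendsto (fun n => μ.real {ω | a n * (partialMax X n ω - b n) ≤ t})
      atTop (𝓝 (G t)))
    (x : ℝ) (hx : 0 < G x) :
    (∃ (Ω' : Type) (_ : MeasurableSpace Ω') (P : Measure Ω') (_ : IsProbabilityMeasure P)
        (N : Ω' → FiniteMeasure (Set.Ioc (0 : ℝ) 1)),
      IsPoissonProcess N ((-Real.log (G x)).toNNReal • lebesgueIoc) P ∧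
      TendstoInLaw (exceedanceProcess X (fun n => x / a n + b n)) N μ P) ∧
    AsymptoticallyIndependent (exceedanceProcess X (fun n => x / a n + b n))
      (fun n ω => partialSum X n ω / √(n : ℝ)) μ := by
  have hu := tendsto_nat_mul_measureReal_Ioi hX_meas hX_indep hX_ident ha hx (hlim x)
  -- The intensity is nonnegative as a limit of expected numbers of exceedances.
  have hle : 0 ≤ -Real.log (G x) :=
    ge_of_tendsto' hu fun n => mul_nonneg n.cast_nonneg measureReal_nonneg
  rw [← Real.coe_toNNReal _ hle] at hu
  exact ⟨⟨_, _, _, inferInstance, _, isPoissonProcess_samplePointMeasure _ lebesgueIoc,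
    tendstoInLaw_exceedanceProcess hX_meas hX_indep hX_ident hu⟩,
    asymptoticallyIndependent_exceedanceProcess hX_meas hX_indep hX_ident hX_mean hX_sq hu⟩
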